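/- Let $(Y_i)_{i\ge 1}$ be a centered stationary Gaussian process with variance $1$ and correlation function $\rho$ satisfying $\rho(i)\sim\kappa|i|^{-\alpha}$ as $|i|\to\infty$, that is, $|i|^{\alpha}\rho(i)\to\kappa$, for some $\kappa\in\mathbb R$ and $\alpha>0$. Let $p\in(0,1)$, let $Y\sim\mathcal N(0,1)$, and let $h:\mathbb R\to\mathbb R$ be a measurable function with $\mathbf E\,h(Y)^2<\infty$. Define $$E:=E_{h(Y)}(p):=\operatorname{argmin}_{\theta\in\mathbb R}\ \mathbf E\big[|p-\mathbf 1_{h(Y)\le\theta}|\,(h(Y)-\theta)^2\big],\qquad \widehat E_n:=\operatorname{argmin}_{\theta\in\mathbb R}\ \frac1n\sum_{i=1}^n|p-\mathbf 1_{h(Y_i)\le\theta}|\,(h(Y_i)-\theta)^2,$$ $$\psi(\theta):=\mathbf E\big[|p-\mathbf 1_{h(Y)\le\theta}|\,(h(Y)-\theta)\big],\qquad \psi'(\theta):=-\mathbf E\big[|p-\mathbf 1_{h(Y)\le\theta}|\big],\qquad \psi_n(\theta):=\frac1n\sum_{i=1}^n|p-\mathbf 1_{h(Y_i)\le\theta}|\,(h(Y_i)-\theta).$$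 Assume that $\psi$ is continuously differentiable in a neighborhood of $E$ with negative derivative at $E$. Let $\tau$ be the Hermite rank of the centered score function $t\mapsto|p-\mathbf 1_{h(t)\le E}|\,(h(t)-E)-\psi(E)$, that is, the smallest integer $j$ for which its $j$-th Hermite coefficient (the expectation, at $t=Y$, of its product with the $j$-th Hermite polynomial $H_j$) is nonzero; such a $j$ is assumed to exist. Then, as $n\to\infty$, $$\widehat E_n-E=-\frac{\psi_n(E)}{\psi'(E)}+o_P(r_n),\qquad r_n=\begin{cases}n^{-1/2}&\text{if }\alpha\tau>1,\\ n^{-1/2}\log n&\text{if }\alpha\tau=1,\\ n^{-\alpha\tau/2}&\text{if }\alpha\tau<1.\end{cases}$$ -/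

import Mathlib

open MeasureTheory ProbabilityTheory Filter Topology

noncomputable section

namespace Expectile

/-- A global minimiser over `ℝ` of the criterion `f` (an arbitrary real number if there is none).
For `0 < p < 1` the expectile criteria below are strictly convex and coercive as soon as the
variable is square integrable, resp. the sample is nonempty: there is exactly one minimiser. -/
def argmin (f : ℝ → ℝ) : ℝ :=
  Classical.epsilon fun θ => ∀ θ' : ℝ, f θ ≤ f θ'

/-- The asymmetric weight `|p - 1_{z ≤ θ}|`. -/
def weight (p z θ : ℝ) : ℝ :=
  |p - if z ≤ θ then 1 else 0|

/-- The `p`-th expectile of `h(Y)`, for `Y` standard normal. -/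
def expectile (h : ℝ → ℝ) (p : ℝ) : ℝ :=
  argmin fun θ => ∫ t, weight p (h t) θ * (h t - θ) ^ 2 ∂(gaussianReal 0 1)

/-- The sample `p`-th expectile of the first `n` values `z 0, …, z (n - 1)` of a sequence. -/
def sampleExpectile (n : ℕ) (z : ℕ → ℝ) (p : ℝ) : ℝ :=
  argmin fun θ => (1 / (n : ℝ)) * ∑ i ∈ Finset.range n, weight p (z i) θ * (z i - θ) ^ 2

/-- The sample score `ψ_n(θ; z) = n⁻¹ ∑_i |p - 1_{z_i ≤ θ}| (z_i - θ)`. -/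
def samplePsi (n : ℕ) (z : ℕ → ℝ) (p θ : ℝ) : ℝ :=
  (1 / (n : ℝ)) * ∑ i ∈ Finset.range n, weight p (z i) θ * (z i - θ)

/-- The score `ψ_{h(Y)}(θ; p) = E[|p - 1_{h(Y) ≤ θ}| (h(Y) - θ)]`, for `Y` standard normal. -/
def psi (h : ℝ → ℝ) (p θ : ℝ) : ℝ :=
  ∫ t, weight p (h t) θ * (h t - θ) ∂(gaussianReal 0 1)

/-- `ψ'_{h(Y)}(θ; p) = - E[|p - 1_{h(Y) ≤ θ}|]`, for `Y` standard normal. -/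
def psi' (h : ℝ → ℝ) (p θ : ℝ) : ℝ :=
  -∫ t, weight p (h t) θ ∂(gaussianReal 0 1)

/-- The centered score function `t ↦ |p - 1_{h(t) ≤ θ}| (h(t) - θ) - ψ_{h(Y)}(θ; p)`. -/
def centeredScore (h : ℝ → ℝ) (p θ t : ℝ) : ℝ :=
  weight p (h t) θ * (h t - θ) - psi h p θ

/-- The assumption `[A(h,p)]`: `h` is measurable, `E h(Y)² < ∞`, and `ψ_{h(Y)}(·; p)` is
continuously differentiable near the expectile, with negative derivative there. -/
structure AssumptionA (h : ℝ → ℝ) (p : ℝ) : Prop where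
  measurable : Measurable h
  memLp_two : MemLp h 2 (gaussianReal 0 1)
  contDiffOn_nhds : ∃ U : Set ℝ, IsOpen U ∧ expectile h p ∈ U ∧ ContDiffOn ℝ 1 (psi h p) U
  deriv_neg : deriv (psi h p) (expectile h p) < 0

/-- The `j`-th Hermite coefficient `E[f(Y) H_j(Y)]`, for `Y` standard normal, with the
probabilists' Hermite polynomials. -/
def hermiteCoeff (f : ℝ → ℝ) (j : ℕ) : ℝ :=
  ∫ t, f t * Polynomial.aeval t (Polynomial.hermite j) ∂(gaussianReal 0 1)

/-- `τ` is the Hermite rank of `f`: the least index of a nonzero Hermite coefficient. -/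
def IsHermiteRank (f : ℝ → ℝ) (τ : ℕ) : Prop :=
  IsLeast {j : ℕ | hermiteCoeff f j ≠ 0} τ

/-- `Y` is a centered stationary Gaussian sequence with unit variance and correlation function
`ρ`. (For a centered Gaussian process, strict stationarity is the same as covariances which
depend on the lag only; as the variance is one, covariances are correlations.) -/
structure IsStationaryGaussian {Ω : Type*} [MeasurableSpace Ω] (P : Measure Ω)
    (Y : ℕ → Ω → ℝ) (ρ : ℕ → ℝ) : Prop where
  isGaussianProcess : IsGaussianProcess Y P
  centered : ∀ i, ∫ ω, Y i ω ∂P = 0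
  variance_eq_one : ∀ i, variance (Y i) P = 1
  covariance_eq : ∀ i k, covariance (Y i) (Y (i + k)) P = ρ k

/-- The rate `r_n(α, τ)`. -/
def rate (α : ℝ) (τ : ℕ) (n : ℕ) : ℝ :=
  if 1 < α * τ then (n : ℝ) ^ (-(1 / 2) : ℝ)
  else if α * τ = 1 then (n : ℝ) ^ (-(1 / 2) : ℝ) * Real.log n
  else (n : ℝ) ^ (-(α * τ) / 2)

/-- `X_n = o_P(r_n)`: the sequence `X_n / r_n` converges to `0` in probability. -/
def IsLittleOP {Ω : Type*} [MeasurableSpace Ω] (P : Measure Ω)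
    (X : ℕ → Ω → ℝ) (r : ℕ → ℝ) : Prop :=
  TendstoInMeasure P (fun n ω => X n ω / r n) atTop (fun _ => (0 : ℝ))

end Expectile

end

/-! The argument splits into a deterministic inequality and moment bounds. Write c = min(p, 1 - p),
b = -ψ'(E) and D for the estimation error. The expectile criterion is strongly convex, so the score
is strongly monotone and c|D| ≤ |ψ_n(E)| for every nonempty sample. The score is also piecewise
affine in θ: expanding ψ_n = 0 from the sample expectile back to E gives D W = ψ_n(E) up to an error
|D| |2p - 1| N whenever |D| ≤ δ, where W is the mean weight at E and N the fraction of observations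
within δ of E. Replacing W by b yields c²|D - ψ_n(E)/b| ≤ |ψ_n(E)| (|W - b| + |2p - 1| N), which is
`abs_sampleExpectile_sub_sub_le`.

It remains to see that the first factor is O_P(r_n) and the second is small. For a standard Gaussian
pair of correlation r, the Hermite expansion gives E g(X) g(X') = ∑ c_k² r^k, at most |r|^τ E g²
when the coefficients below τ vanish (`abs_integral_mul_le`). Summing over lags gives E ψ_n(E)² =
O(r_n²) with the Hermite rank, and with exponent 1 in place of τ it gives W → b in L². The mean of N
is P(|h(Y) - E| ≤ δ). Differentiability of ψ at E excludes an atom of h(Y) at E unless p = 1/2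
(`abs_mul_measureReal_eq_zero`), so |2p - 1| E N is small for small δ. Markov's inequality
concludes; no uniform law over θ is needed. -/

/-! ### Hermite polynomials -/

open Polynomial in
theorem Polynomial.derivative_hermite_succ (n : ℕ) :
    derivative (hermite (n + 1)) = (n + 1 : ℤ[X]) * hermite n := by
  induction n with
  | zero => simp
  | succ n ih =>
    have h1 : derivative (derivative (hermite (n + 1))) = (n + 1 : ℤ[X]) * derivative (hermite n) := by
      rw [ih]
      have : derivative ((n + 1 : ℤ[X])) = 0 := by
        simp
      rw [derivative_mul, this]; ring
    rw [hermite_succ (n + 1), derivative_sub, derivative_mul, derivative_X, h1, ih, hermite_succ n]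
    push_cast
    ring

namespace Expectile

/-- The probabilists' Hermite polynomial with real coefficients. -/
noncomputable def realHermite (n : ℕ) : Polynomial ℝ :=
  (Polynomial.hermite n).map (Int.castRingHom ℝ)

theorem aeval_hermite (n : ℕ) (t : ℝ) :
    Polynomial.aeval t (Polynomial.hermite n) = (realHermite n).eval t := by
  simp [realHermite, Polynomial.eval_map, Polynomial.aeval_def]

theorem realHermite_zero : realHermite 0 = 1 := by simp [realHermite]

theorem realHermite_succ (n : ℕ) :
    realHermite (n + 1) = Polynomial.X * realHermite n - Polynomial.derivative (realHermite n) := by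
  simp [realHermite, Polynomial.hermite_succ, Polynomial.derivative_map]

theorem derivative_realHermite_succ (n : ℕ) :
    Polynomial.derivative (realHermite (n + 1)) = Polynomial.C (n + 1 : ℝ) * realHermite n := by
  rw [realHermite, Polynomial.derivative_map, Polynomial.derivative_hermite_succ]
  simp [realHermite]

/-! ### Polynomials of Gaussian variables and Stein's identity -/

section Gaussian

variable {Ω : Type*} [MeasurableSpace Ω] {P : Measure Ω}

theorem memLp_two_eval {X : Ω → ℝ} (hX : HasGaussianLaw X P) (F : Polynomial ℝ) :
    MemLp (fun ω => F.eval (X ω)) 2 P := by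
  have := hX.isProbabilityMeasure
  have hpow (n : ℕ) : MemLp (fun ω => X ω ^ n) 2 P := by
    rw [memLp_two_iff_integrable_sq (hX.aemeasurable.pow_const n).aestronglyMeasurable]
    have h := (hX.memLp (p := ((2 * n : ℕ) : ENNReal)) (ENNReal.natCast_ne_top _)).integrable_norm_pow'
    refine h.congr (ae_of_all _ fun ω => ?_)
    simp only [Real.norm_eq_abs]
    rw [← pow_mul, mul_comm n 2, pow_mul, sq_abs, pow_mul]
  induction F using Polynomial.induction_on' with
  | add p q hp hq => simpa using! hp.add hq
  | monomial n a => simpa using (hpow n).const_mul a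

theorem integrable_eval_mul_eval {X X' : Ω → ℝ} (hX : HasGaussianLaw X P)
    (hX' : HasGaussianLaw X' P) (F G : Polynomial ℝ) :
    Integrable (fun ω => F.eval (X ω) * G.eval (X' ω)) P :=
  (memLp_two_eval hX F).integrable_mul (memLp_two_eval hX' G)

theorem memLp_two_eval_gaussianReal (F : Polynomial ℝ) :
    MemLp (fun x => F.eval x) 2 (gaussianReal 0 1) :=
  memLp_two_eval (IsGaussian.hasGaussianLaw_id (μ := gaussianReal 0 1)) F

theorem integrable_eval_gaussianReal (F : Polynomial ℝ) :
    Integrable (fun x => F.eval x) (gaussianReal 0 1) :=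
  (memLp_two_eval_gaussianReal F).integrable one_le_two

theorem integrable_gaussianPDFReal_mul_eval (F : Polynomial ℝ) :
    Integrable (fun x => gaussianPDFReal 0 1 x * F.eval x) := by
  have h := integrable_eval_gaussianReal F
  rw [gaussianReal_of_var_ne_zero _ one_ne_zero, integrable_withDensity_iff_integrable_smul'
    (measurable_gaussianPDF 0 1) (ae_of_all _ fun _ => gaussianPDF_lt_top)] at h
  simpa [toReal_gaussianPDF] using h

theorem hasDerivAt_gaussianPDFReal (x : ℝ) :
    HasDerivAt (gaussianPDFReal 0 1) (-x * gaussianPDFReal 0 1 x) x := by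
  rw [gaussianPDFReal_def]
  have h1 : HasDerivAt (fun x : ℝ => -(x - 0) ^ 2 / (2 * ((1 : NNReal) : ℝ))) (-x) x := by
    have h := ((((hasDerivAt_id x).sub_const 0).pow 2).neg).div_const (2 * ((1 : NNReal) : ℝ))
    refine h.congr_deriv ?_
    simp
    ring
  refine ((h1.exp).const_mul _).congr_deriv ?_
  ring

/-- Stein's identity for polynomials. -/
theorem integral_mul_eval_gaussianReal (F : Polynomial ℝ) :
    ∫ x, x * F.eval x ∂(gaussianReal 0 1) =
      ∫ x, (Polynomial.derivative F).eval x ∂(gaussianReal 0 1) := by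
  have hX : Integrable (fun x => x * F.eval x) (gaussianReal 0 1) := by
    exact (integrable_eval_gaussianReal (Polynomial.X * F)).congr (ae_of_all _ fun x => by simp)
  rw [← sub_eq_zero, ← integral_sub hX (integrable_eval_gaussianReal _),
    integral_gaussianReal_eq_integral_smul one_ne_zero]
  have h := integral_eq_zero_of_hasDerivAt_of_integrable
    (f := fun x => -(gaussianPDFReal 0 1 x * F.eval x))
    (f' := fun x => gaussianPDFReal 0 1 x • (x * F.eval x - (Polynomial.derivative F).eval x))
    (fun x => by
      refine (((hasDerivAt_gaussianPDFReal x).mul (F.hasDerivAt x)).neg).congr_deriv ?_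
      simp only [smul_eq_mul]; ring)
    ((integrable_gaussianPDFReal_mul_eval (Polynomial.X * F - Polynomial.derivative F)).congr
      (ae_of_all _ fun x => by simp))
    (integrable_gaussianPDFReal_mul_eval F).neg
  exact h

end Gaussian

/-! ### Hermite polynomials of a correlated Gaussian pair -/

/-- `X` and `X'` are jointly Gaussian, standard normal, with correlation `r`. -/
structure IsStdGaussianPair {Ω : Type*} [MeasurableSpace Ω] (P : Measure Ω) (X X' : Ω → ℝ)
    (r : ℝ) : Prop where
  hasGaussianLaw : HasGaussianLaw (fun ω => (X ω, X' ω)) P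
  map_fst : P.map X = gaussianReal 0 1
  map_snd : P.map X' = gaussianReal 0 1
  covariance_eq : covariance X X' P = r

namespace IsStdGaussianPair

variable {Ω : Type*} [MeasurableSpace Ω] {P : Measure Ω} {X X' : Ω → ℝ} {r : ℝ}

theorem exists_residual (h : IsStdGaussianPair P X X' r) :
    HasGaussianLaw (fun ω => (X ω, X' ω - r * X ω)) P ∧
      IndepFun X (fun ω => X' ω - r * X ω) P := by
  have hP := h.hasGaussianLaw.isProbabilityMeasure
  let L : ℝ × ℝ →L[ℝ] ℝ × ℝ :=
    (ContinuousLinearMap.fst ℝ ℝ ℝ).prod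
      (ContinuousLinearMap.snd ℝ ℝ ℝ - r • ContinuousLinearMap.fst ℝ ℝ ℝ)
  have hL : HasGaussianLaw (fun ω => (X ω, X' ω - r * X ω)) P := by
    simpa [L] using h.hasGaussianLaw.map_fun L
  refine ⟨hL, hL.indepFun_of_covariance_eq_zero ?_⟩
  have hX := h.hasGaussianLaw.fst.memLp_two
  have hX' := h.hasGaussianLaw.snd.memLp_two
  have hvar : Var[X; P] = 1 := by
    have := variance_map (X := id) (μ := P) (Y := X) aemeasurable_id h.hasGaussianLaw.fst.aemeasurable
    rw [h.map_fst, variance_id_gaussianReal] at this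
    simpa using this.symm
  have : (fun ω => X' ω - r * X ω) = X' - r • X := rfl
  rw [this, covariance_sub_right hX hX' (hX.const_smul r), covariance_smul_right,
    covariance_self h.hasGaussianLaw.fst.aemeasurable, hvar, h.covariance_eq]
  ring

/-- Stein's identity in `X` with the independent regression residual `W = X' - r X` frozen; the
chain rule through `X' = r X + W` produces the factor `r`. -/
theorem integral_mul_eval_mul_eval (h : IsStdGaussianPair P X X' r) (F G : Polynomial ℝ) :
    ∫ ω, X ω * F.eval (X ω) * G.eval (X' ω) ∂P =
      (∫ ω, (Polynomial.derivative F).eval (X ω) * G.eval (X' ω) ∂P) +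
        r * ∫ ω, F.eval (X ω) * (Polynomial.derivative G).eval (X' ω) ∂P := by
  have hP := h.hasGaussianLaw.isProbabilityMeasure
  obtain ⟨hW, hind⟩ := h.exists_residual
  set W : Ω → ℝ := fun ω => X' ω - r * X ω with hWdef
  have hXm := h.hasGaussianLaw.fst.aemeasurable
  have hX'W (ω : Ω) : X' ω = r * X ω + W ω := by simp [hWdef]
  have hlaw : P.map (fun ω => (X ω, W ω)) = (gaussianReal 0 1).prod (P.map W) := by
    rw [(indepFun_iff_map_prod_eq_prod_map_map hXm hW.snd.aemeasurable).1 hind, h.map_fst]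
  have hνp : IsProbabilityMeasure (P.map W) :=
    Measure.isProbabilityMeasure_map hW.snd.aemeasurable
  have hc (A B : Polynomial ℝ) :
      Continuous (fun z : ℝ × ℝ => A.eval z.1 * B.eval (r * z.1 + z.2)) :=
    (A.continuous.comp continuous_fst).mul (B.continuous.comp (by fun_prop))
  have key (A B : Polynomial ℝ) : Integrable (fun z : ℝ × ℝ => A.eval z.1 * B.eval (r * z.1 + z.2))
      ((gaussianReal 0 1).prod (P.map W)) ∧ ∫ ω, A.eval (X ω) * B.eval (X' ω) ∂P =
      ∫ w, ∫ x, A.eval x * B.eval (r * x + w) ∂(gaussianReal 0 1) ∂(P.map W) := by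
    have hint : Integrable (fun z : ℝ × ℝ => A.eval z.1 * B.eval (r * z.1 + z.2))
        ((gaussianReal 0 1).prod (P.map W)) := by
      rw [← hlaw, integrable_map_measure (hc A B).aestronglyMeasurable hW.aemeasurable]
      refine (integrable_eval_mul_eval h.hasGaussianLaw.fst h.hasGaussianLaw.snd A B).congr
        (ae_of_all _ fun ω => ?_)
      simp [hX'W]
    refine ⟨hint, ?_⟩
    rw [← integral_prod_symm _ hint, ← hlaw, integral_map hW.aemeasurable
      (hc A B).aestronglyMeasurable]
    simp [hX'W]
  have e1 : ∫ ω, X ω * F.eval (X ω) * G.eval (X' ω) ∂P =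
      ∫ ω, (Polynomial.X * F).eval (X ω) * G.eval (X' ω) ∂P := by simp
  rw [e1, (key _ _).2, (key _ _).2, (key _ _).2, ← integral_const_mul, ← integral_add]
  · congr 1 with w
    set Q : Polynomial ℝ := G.comp (Polynomial.C r * Polynomial.X + Polynomial.C w) with hQ
    have hst := integral_mul_eval_gaussianReal (F * Q)
    have hd : Polynomial.derivative (F * Q) = Polynomial.derivative F * Q +
        Polynomial.C r * (F * (Polynomial.derivative G).comp
          (Polynomial.C r * Polynomial.X + Polynomial.C w)) := by
      rw [Polynomial.derivative_mul, hQ, Polynomial.derivative_comp]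
      simp
      ring
    have h1 := integrable_eval_gaussianReal (Polynomial.derivative F * Q)
    have h2 := integrable_eval_gaussianReal (Polynomial.C r * (F * (Polynomial.derivative G).comp
          (Polynomial.C r * Polynomial.X + Polynomial.C w)))
    rw [hd] at hst
    simp only [Polynomial.eval_add] at hst
    rw [integral_add h1 h2] at hst
    simp only [hQ, Polynomial.eval_mul, Polynomial.eval_comp, Polynomial.eval_add,
      Polynomial.eval_C, Polynomial.eval_X, integral_const_mul] at hst ⊢
    rw [← hst]
    simp only [mul_assoc]
  · exact (key _ _).1.integral_prod_right
  · exact ((key _ _).1.integral_prod_right).const_mul r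

/-- The recursion for `realHermite (m + 1)` cancels the first term of the Stein identity, so each
step lowers both indices by one and gains a factor `r * (n + 1)`. -/
theorem integral_realHermite_mul (h : IsStdGaussianPair P X X' r) (m n : ℕ) :
    ∫ ω, (realHermite m).eval (X ω) * (realHermite n).eval (X' ω) ∂P =
      if m = n then (n.factorial : ℝ) * r ^ n else 0 := by
  have hP := h.hasGaussianLaw.isProbabilityMeasure
  have hfst := h.hasGaussianLaw.fst
  have hsnd := h.hasGaussianLaw.snd
  have step (m : ℕ) (G : Polynomial ℝ) :
      ∫ ω, (realHermite (m + 1)).eval (X ω) * G.eval (X' ω) ∂P =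
        r * ∫ ω, (realHermite m).eval (X ω) * (Polynomial.derivative G).eval (X' ω) ∂P := by
    have h1 := h.integral_mul_eval_mul_eval (realHermite m) G
    have h2 : Integrable (fun ω => X ω * (realHermite m).eval (X ω) * G.eval (X' ω)) P := by
      exact (integrable_eval_mul_eval hfst hsnd (Polynomial.X * realHermite m) G).congr
        (ae_of_all _ fun ω => by simp)
    rw [realHermite_succ]
    simp only [Polynomial.eval_sub, Polynomial.eval_mul, Polynomial.eval_X, sub_mul]
    rw [integral_sub h2 (integrable_eval_mul_eval hfst hsnd _ _), h1]
    ring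
  induction m generalizing n with
  | zero =>
    cases n with
    | zero => simp [realHermite_zero]
    | succ n =>
      have hst := integral_mul_eval_gaussianReal (realHermite n)
      have hX : Integrable (fun x => x * (realHermite n).eval x) (gaussianReal 0 1) := by
        exact (integrable_eval_gaussianReal (Polynomial.X * realHermite n)).congr
          (ae_of_all _ fun x => by simp)
      have : ∫ x, (realHermite (n + 1)).eval x ∂(gaussianReal 0 1) = 0 := by
        rw [realHermite_succ]
        simp only [Polynomial.eval_sub, Polynomial.eval_mul, Polynomial.eval_X]
        rw [integral_sub hX (integrable_eval_gaussianReal _), hst, sub_self]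
      rw [← h.map_snd, integral_map hsnd.aemeasurable
        (Polynomial.continuous _).aestronglyMeasurable] at this
      simpa [realHermite_zero] using this
  | succ m ih =>
    rw [step]
    cases n with
    | zero => simp [realHermite_zero]
    | succ n =>
      rw [derivative_realHermite_succ]
      have : ∀ ω, (realHermite m).eval (X ω) *
          (Polynomial.C (n + 1 : ℝ) * realHermite n).eval (X' ω) =
          (n + 1 : ℝ) * ((realHermite m).eval (X ω) * (realHermite n).eval (X' ω)) := by
        intro ω; simp; ring
      simp only [this, integral_const_mul, ih, Nat.add_right_cancel_iff]
      split_ifs with hmn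
      · rw [Nat.factorial_succ]; push_cast; ring
      · simp

end IsStdGaussianPair

/-! ### Completeness of the Hermite system -/

open Complex in
/-- A square integrable function all of whose moments against the standard normal law vanish
is zero. -/
theorem ae_eq_zero_of_forall_integral_mul_pow_eq_zero {f : ℝ → ℝ}
    (hf : MemLp f 2 (gaussianReal 0 1))
    (h0 : ∀ n : ℕ, ∫ x, f x * x ^ n ∂(gaussianReal 0 1) = 0) :
    f =ᵐ[gaussianReal 0 1] 0 := by
  set γ := gaussianReal 0 1
  have hfi : Integrable f γ := hf.integrable one_le_two
  have hexp (t : ℝ) : MemLp (fun x => Real.exp |t * x|) 2 γ := by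
    have hm : Continuous fun x : ℝ => Real.exp |t * x| := by fun_prop
    rw [memLp_two_iff_integrable_sq hm.aestronglyMeasurable]
    have h := integrable_exp_mul_abs (X := id) (μ := γ) (t := 2 * |t|)
      (integrable_exp_mul_gaussianReal _) (integrable_exp_mul_gaussianReal _)
    refine h.congr (ae_of_all _ fun x => ?_)
    simp only [id]
    rw [← Real.exp_nat_mul, abs_mul]
    push_cast; ring_nf
  -- The exponential series is integrated termwise, dominated by `|f x| * exp |t x|`, which is
  -- integrable by Cauchy–Schwarz; every term is a vanishing moment.
  have hchar (t : ℝ) : ∫ x, (f x : ℂ) * cexp (t * x * I) ∂γ = 0 := by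
    have hs := hasSum_integral_of_dominated_convergence (μ := γ)
      (F := fun (n : ℕ) x => (f x : ℂ) * ((t * x * I) ^ n / n.factorial))
      (f := fun x => (f x : ℂ) * cexp (t * x * I))
      (fun n x => |f x| * (|t * x| ^ n / n.factorial)) ?_ ?_ ?_ ?_ ?_
    · refine hs.unique ?_
      convert hasSum_zero with n
      have : ∀ x : ℝ, (f x : ℂ) * ((t * x * I) ^ n / n.factorial) =
          ((t * I) ^ n / n.factorial) * ((f x * x ^ n : ℝ) : ℂ) := by
        intro x; push_cast; ring
      simp only [this, integral_const_mul, integral_complex_ofReal]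
      rw [h0 n]; simp
    · intro n
      refine (continuous_ofReal.comp_aestronglyMeasurable hf.1).mul ?_
      exact Continuous.aestronglyMeasurable (by fun_prop)
    · intro n
      exact ae_of_all _ fun x => by simp
    · exact ae_of_all _ fun x => ((Real.summable_pow_div_factorial _).mul_left _)
    · have h := hf.abs.integrable_mul (hexp t)
      refine h.congr (ae_of_all _ fun x => ?_)
      simp only [Pi.mul_apply]
      rw [tsum_mul_left, Real.exp_eq_exp_ℝ, NormedSpace.exp_eq_tsum_div]
      rfl
    · refine ae_of_all _ fun x => ?_
      have := (NormedSpace.expSeries_div_hasSum_exp (t * x * I : ℂ))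
      rw [← Complex.exp_eq_exp_ℂ] at this
      exact this.mul_left _
  -- `ENNReal.ofReal` truncates at zero, so these measures have the positive and negative parts of
  -- `f` as densities; equal characteristic functions force the parts to agree.
  set μ₁ := γ.withDensity fun x => ENNReal.ofReal (f x)
  set μ₂ := γ.withDensity fun x => ENNReal.ofReal (-f x)
  have : IsFiniteMeasure μ₁ := isFiniteMeasure_withDensity_ofReal hfi.2
  have : IsFiniteMeasure μ₂ := isFiniteMeasure_withDensity_ofReal hfi.neg.2
  have hw (g : ℝ → ℝ) (hg : Integrable g γ) (t : ℝ) :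
      charFun (γ.withDensity fun x => ENNReal.ofReal (g x)) t =
        ∫ x, ((max (g x) 0 : ℝ) : ℂ) * cexp (t * x * I) ∂γ := by
    rw [charFun_apply_real, integral_withDensity_eq_integral_toReal_smul₀
      hg.1.aemeasurable.ennreal_ofReal (ae_of_all _ fun _ => ENNReal.ofReal_lt_top)]
    simp [ENNReal.toReal_ofReal']
  have hint (g : ℝ → ℝ) (hg : Integrable g γ) (t : ℝ) :
      Integrable (fun x => ((max (g x) 0 : ℝ) : ℂ) * cexp (t * x * I)) γ := by
    refine (hg.pos_part.ofReal (𝕜 := ℂ)).mul_bdd (c := 1) (Continuous.aestronglyMeasurable (by fun_prop))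
      (ae_of_all _ fun x => ?_)
    rw [← ofReal_mul, norm_exp_ofReal_mul_I]
  have heq : μ₁ = μ₂ := by
    refine Measure.ext_of_charFun (funext fun t => ?_)
    rw [hw f hfi t, hw (fun x => -f x) hfi.neg t, ← sub_eq_zero,
      ← integral_sub (hint _ hfi t) (hint (fun x => -f x) hfi.neg t), ← hchar t]
    congr 1 with x
    rw [← sub_mul, ← ofReal_sub]
    congr 2
    rcases le_total (f x) 0 with h | h
    · rw [max_eq_right h, max_eq_left (by linarith)]; ring
    · rw [max_eq_left h, max_eq_right (by linarith)]; ring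
  have hd := (withDensity_eq_iff hfi.1.aemeasurable.ennreal_ofReal
    hfi.neg.1.aemeasurable.ennreal_ofReal hfi.lintegral_lt_top.ne).1 heq
  filter_upwards [hd] with x hx
  have hx' := congrArg ENNReal.toReal hx
  simp only [ENNReal.toReal_ofReal', Pi.neg_apply, Pi.zero_apply] at hx' ⊢
  rcases le_total (f x) 0 with h | h
  · rw [max_eq_right h, max_eq_left (by linarith)] at hx'; linarith
  · rw [max_eq_left h, max_eq_right (by linarith)] at hx'; linarith

/-- Multiplication by X maps each Hermite polynomial to a combination of two others, so
orthogonality propagates to all X^n H_m; the case m = 0 gives the moments. -/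
theorem ae_eq_zero_of_forall_integral_mul_realHermite_eq_zero {f : ℝ → ℝ}
    (hf : MemLp f 2 (gaussianReal 0 1))
    (h0 : ∀ n : ℕ, ∫ x, f x * (realHermite n).eval x ∂(gaussianReal 0 1) = 0) :
    f =ᵐ[gaussianReal 0 1] 0 := by
  have hint (F : Polynomial ℝ) : Integrable (fun x => f x * F.eval x) (gaussianReal 0 1) :=
    hf.integrable_mul (memLp_two_eval_gaussianReal F)
  have key (n : ℕ) : ∀ m, ∫ x, f x * (Polynomial.X ^ n * realHermite m).eval x
      ∂(gaussianReal 0 1) = 0 := by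
    induction n with
    | zero => simpa using h0
    | succ n ih =>
      have hrec (m : ℕ) : ∃ c : ℝ, ∃ k, Polynomial.X * realHermite m =
          realHermite (m + 1) + Polynomial.C c * realHermite k := by
        rw [realHermite_succ]
        cases m with
        | zero => exact ⟨0, 0, by simp [realHermite_zero]⟩
        | succ m => exact ⟨m + 1, m, by rw [derivative_realHermite_succ]; ring⟩
      intro m
      obtain ⟨c, k, hc⟩ := hrec m
      have e : Polynomial.X ^ (n + 1) * realHermite m = Polynomial.X ^ n * realHermite (m + 1) +
          Polynomial.C c * (Polynomial.X ^ n * realHermite k) := by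
        rw [pow_succ, mul_assoc, hc]; ring
      have e2 (x : ℝ) : f x * (Polynomial.X ^ (n + 1) * realHermite m).eval x =
          f x * (Polynomial.X ^ n * realHermite (m + 1)).eval x +
            c * (f x * (Polynomial.X ^ n * realHermite k).eval x) := by
        rw [e, Polynomial.eval_add, Polynomial.eval_mul (p := Polynomial.C c),
          Polynomial.eval_C]; ring
      simp only [e2]
      rw [integral_add (hint _) ((hint _).const_mul c), integral_const_mul, ih, ih]
      simp
  refine ae_eq_zero_of_forall_integral_mul_pow_eq_zero hf fun n => ?_
  simpa [realHermite_zero] using key n 0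

/-- The normalised Hermite polynomials as elements of `L²` of the standard normal law. -/
noncomputable def hermiteLp (n : ℕ) : Lp ℝ 2 (gaussianReal 0 1) :=
  (√(n.factorial : ℝ))⁻¹ • (memLp_two_eval_gaussianReal (realHermite n)).toLp

theorem coeFn_hermiteLp (n : ℕ) : hermiteLp n =ᵐ[gaussianReal 0 1]
    fun x => (√(n.factorial : ℝ))⁻¹ * (realHermite n).eval x := by
  filter_upwards [Lp.coeFn_smul (√(n.factorial : ℝ))⁻¹
    (memLp_two_eval_gaussianReal (realHermite n)).toLp,
    (memLp_two_eval_gaussianReal (realHermite n)).coeFn_toLp] with x hx hx'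
  rw [hermiteLp, hx, Pi.smul_apply, hx', smul_eq_mul]

theorem isStdGaussianPair_id : IsStdGaussianPair (gaussianReal 0 1) id id 1 where
  hasGaussianLaw := (IsGaussian.hasGaussianLaw_id (μ := gaussianReal 0 1)).map_fun
    ((ContinuousLinearMap.id ℝ ℝ).prod (ContinuousLinearMap.id ℝ ℝ))
  map_fst := Measure.map_id
  map_snd := Measure.map_id
  covariance_eq := by
    rw [covariance_self aemeasurable_id, variance_id_gaussianReal]; rfl

theorem normalised_factorial (n : ℕ) (c : ℝ) :
    (√(n.factorial : ℝ))⁻¹ * ((√(n.factorial : ℝ))⁻¹ * ((n.factorial : ℝ) * c)) = c := by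
  have h : 0 < (n.factorial : ℝ) := by exact_mod_cast n.factorial_pos
  have h2 := Real.mul_self_sqrt h.le
  have h3 := Real.sqrt_pos.2 h
  field_simp
  rw [sq, h2]

theorem orthonormal_hermiteLp : Orthonormal ℝ hermiteLp := by
  rw [orthonormal_iff_ite]
  intro m n
  have h := isStdGaussianPair_id.integral_realHermite_mul m n
  have e : ∫ x, inner ℝ (hermiteLp m x) (hermiteLp n x) ∂(gaussianReal 0 1) =
      ∫ x, (√(m.factorial : ℝ))⁻¹ * ((√(n.factorial : ℝ))⁻¹ *
        ((realHermite m).eval x * (realHermite n).eval x)) ∂(gaussianReal 0 1) := by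
    refine integral_congr_ae ?_
    filter_upwards [coeFn_hermiteLp m, coeFn_hermiteLp n] with x h1 h2
    rw [h1, h2]
    simp only [RCLike.inner_apply, conj_trivial]
    ring
  rw [L2.inner_def, e, integral_const_mul, integral_const_mul]
  simp only [id] at h
  rw [h]
  split_ifs with hmn
  · subst hmn; exact (normalised_factorial m _).trans (by simp)
  · simp

theorem inner_hermiteLp (n : ℕ) (g : Lp ℝ 2 (gaussianReal 0 1)) :
    inner ℝ (hermiteLp n) g = (√(n.factorial : ℝ))⁻¹ *
      ∫ x, g x * (realHermite n).eval x ∂(gaussianReal 0 1) := by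
  rw [L2.inner_def, ← integral_const_mul]
  refine integral_congr_ae ?_
  filter_upwards [coeFn_hermiteLp n] with x h1
  rw [h1]
  simp only [RCLike.inner_apply, conj_trivial]
  ring

theorem orthogonal_span_hermiteLp : (Submodule.span ℝ (Set.range hermiteLp))ᗮ = ⊥ := by
  rw [eq_bot_iff]
  intro g hg
  rw [Submodule.mem_orthogonal] at hg
  rw [Submodule.mem_bot, Lp.eq_zero_iff_ae_eq_zero]
  refine ae_eq_zero_of_forall_integral_mul_realHermite_eq_zero (Lp.memLp g) fun n => ?_
  have h := hg (hermiteLp n) (Submodule.subset_span ⟨n, rfl⟩)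
  rw [inner_hermiteLp] at h
  have : 0 < (√(n.factorial : ℝ))⁻¹ := by positivity
  simpa [this.ne'] using h

/-- The Hermite basis of `L²` of the standard normal law. -/
noncomputable def hermiteBasis : HilbertBasis ℕ ℝ (Lp ℝ 2 (gaussianReal 0 1)) :=
  HilbertBasis.mkOfOrthogonalEqBot orthonormal_hermiteLp orthogonal_span_hermiteLp

theorem coe_hermiteBasis : ⇑hermiteBasis = hermiteLp :=
  HilbertBasis.coe_mkOfOrthogonalEqBot _ _

/-! ### Covariance of a function of two correlated Gaussians -/

namespace IsStdGaussianPair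

variable {Ω : Type*} [MeasurableSpace Ω] {P : Measure Ω} {X X' : Ω → ℝ} {r : ℝ}

theorem map_prodMk (h : IsStdGaussianPair P X X' r) :
    IsStdGaussianPair (P.map fun ω => (X ω, X' ω)) Prod.fst Prod.snd r := by
  have hm := h.hasGaussianLaw.aemeasurable
  have := h.hasGaussianLaw.isGaussian_map
  refine ⟨IsGaussian.hasGaussianLaw_id, ?_, ?_, ?_⟩
  · rw [AEMeasurable.map_map_of_aemeasurable (by fun_prop) hm]; exact h.map_fst
  · rw [AEMeasurable.map_map_of_aemeasurable (by fun_prop) hm]; exact h.map_snd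
  · rw [covariance_map (by fun_prop) (by fun_prop) hm]; exact h.covariance_eq

/-- For a standard Gaussian pair with correlation `r`, the correlation of `g(X)` and `g(X')` is at
most `|r| ^ m` if the Hermite coefficients of `g` of index less than `m` vanish. -/
theorem abs_integral_mul_le (h : IsStdGaussianPair P X X' r) {g : ℝ → ℝ}
    (hg : MemLp g 2 (gaussianReal 0 1)) {m : ℕ} (hm : ∀ j < m, hermiteCoeff g j = 0) :
    |∫ ω, g (X ω) * g (X' ω) ∂P| ≤ |r| ^ m * ∫ x, g x ^ 2 ∂(gaussianReal 0 1) := by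
  have hpair := h.map_prodMk
  have hXY := h.hasGaussianLaw.aemeasurable
  set Q : Measure (ℝ × ℝ) := P.map fun ω => (X ω, X' ω)
  have hp1 : MeasurePreserving (Prod.fst : ℝ × ℝ → ℝ) Q (gaussianReal 0 1) :=
    ⟨measurable_fst, hpair.map_fst⟩
  have hp2 : MeasurePreserving (Prod.snd : ℝ × ℝ → ℝ) Q (gaussianReal 0 1) :=
    ⟨measurable_snd, hpair.map_snd⟩
  -- Composition with each coordinate is an isometry into L² of the joint law, so the expectation
  -- becomes an inner product in which the two copies of the Hermite basis are biorthogonal.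
  let J₁ : Lp ℝ 2 (gaussianReal 0 1) →ₗᵢ[ℝ] Lp ℝ 2 Q := Lp.compMeasurePreservingₗᵢ ℝ Prod.fst hp1
  let J₂ : Lp ℝ 2 (gaussianReal 0 1) →ₗᵢ[ℝ] Lp ℝ 2 Q := Lp.compMeasurePreservingₗᵢ ℝ Prod.snd hp2
  have hJ₁ (f : Lp ℝ 2 (gaussianReal 0 1)) : J₁ f =ᵐ[Q] fun z => f z.1 :=
    Lp.coeFn_compMeasurePreserving f hp1
  have hJ₂ (f : Lp ℝ 2 (gaussianReal 0 1)) : J₂ f =ᵐ[Q] fun z => f z.2 :=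
    Lp.coeFn_compMeasurePreserving f hp2
  have hbasis (i j : ℕ) : inner ℝ (J₁ (hermiteLp i)) (J₂ (hermiteLp j)) =
      if i = j then r ^ j else 0 := by
    have e : ∫ z, inner ℝ (J₁ (hermiteLp i) z) (J₂ (hermiteLp j) z) ∂Q =
        ∫ z, (√(i.factorial : ℝ))⁻¹ * ((√(j.factorial : ℝ))⁻¹ *
        ((realHermite i).eval z.1 * (realHermite j).eval z.2)) ∂Q := by
      refine integral_congr_ae ?_
      filter_upwards [hJ₁ (hermiteLp i), hJ₂ (hermiteLp j),
        hp1.quasiMeasurePreserving.ae (coeFn_hermiteLp i),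
        hp2.quasiMeasurePreserving.ae (coeFn_hermiteLp j)] with z h1 h2 h3 h4
      rw [h1, h2, h3, h4]
      simp only [RCLike.inner_apply, conj_trivial]
      ring
    rw [L2.inner_def, e, integral_const_mul, integral_const_mul,
      hpair.integral_realHermite_mul i j]
    split_ifs with hij
    · subst hij; exact normalised_factorial i _
    · simp
  have hr : |r| ≤ 1 := by
    have h1 := hbasis 1 1
    rw [if_pos rfl, pow_one] at h1
    rw [← h1]
    refine (abs_real_inner_le_norm _ _).trans ?_
    rw [J₁.norm_map, J₂.norm_map, orthonormal_hermiteLp.1 1, one_mul]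
  set G : Lp ℝ 2 (gaussianReal 0 1) := hg.toLp
  have hG : G =ᵐ[gaussianReal 0 1] g := hg.coeFn_toLp
  set c : ℕ → ℝ := fun n => hermiteBasis.repr G n
  have hc (n : ℕ) : c n = (√(n.factorial : ℝ))⁻¹ * hermiteCoeff g n := by
    simp only [c]
    rw [HilbertBasis.repr_apply_apply, coe_hermiteBasis, inner_hermiteLp, hermiteCoeff]
    congr 1
    refine integral_congr_ae ?_
    filter_upwards [hG] with x hx
    rw [hx, aeval_hermite]
  have hsum : HasSum (fun n => c n • hermiteLp n) G := by
    have := hermiteBasis.hasSum_repr G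
    rwa [coe_hermiteBasis] at this
  have hcross (i : ℕ) : inner ℝ (J₁ (hermiteLp i)) (J₂ G) = c i * r ^ i := by
    have h1 := (hsum.mapL J₂.toContinuousLinearMap).mapL (innerSL ℝ (J₁ (hermiteLp i)))
    refine h1.unique ?_
    refine (hasSum_ite_eq i (c i * r ^ i)).congr_fun fun j => ?_
    simp only [map_smul, LinearIsometry.coe_toContinuousLinearMap, innerSL_apply_apply, hbasis,
      smul_eq_mul]
    by_cases hij : j = i
    · simp [hij]
    · simp [hij, Ne.symm hij]
  have hmain : HasSum (fun n => c n * (c n * r ^ n)) (inner ℝ (J₁ G) (J₂ G)) := by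
    have h1 := (hsum.mapL J₁.toContinuousLinearMap).mapL (innerSL ℝ (J₂ G))
    rw [real_inner_comm]
    refine h1.congr_fun fun n => ?_
    simp only [map_smul, LinearIsometry.coe_toContinuousLinearMap, innerSL_apply_apply,
      smul_eq_mul]
    rw [real_inner_comm, hcross]
  have hnorm : HasSum (fun n => c n * c n) (∫ x, g x ^ 2 ∂(gaussianReal 0 1)) := by
    have h1 := hermiteBasis.hasSum_inner_mul_inner G G
    have e : inner ℝ G G = ∫ x, g x ^ 2 ∂(gaussianReal 0 1) := by
      rw [L2.inner_def]
      refine integral_congr_ae ?_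
      filter_upwards [hG] with x hx
      rw [hx]; simp [sq]
    rw [e] at h1
    refine h1.congr_fun fun n => ?_
    simp only [c]
    rw [HilbertBasis.repr_apply_apply, real_inner_comm]
  have hlhs : ∫ ω, g (X ω) * g (X' ω) ∂P = inner ℝ (J₁ G) (J₂ G) := by
    have hg1 : AEStronglyMeasurable (fun z : ℝ × ℝ => g z.1 * g z.2) Q :=
      (hg.1.comp_measurePreserving hp1).mul (hg.1.comp_measurePreserving hp2)
    rw [L2.inner_def]
    have := integral_map hXY hg1
    simp only at this
    rw [← this]
    refine integral_congr_ae ?_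
    filter_upwards [hJ₁ G, hJ₂ G, hp1.quasiMeasurePreserving.ae hG,
      hp2.quasiMeasurePreserving.ae hG] with z h1 h2 h3 h4
    rw [h1, h2, h3, h4]
    simp [mul_comm]
  rw [hlhs, ← Real.norm_eq_abs]
  -- Termwise comparison with Parseval: indices below `m` contribute nothing, and above it `|r| ≤ 1`
  -- gives `|r| ^ n ≤ |r| ^ m`.
  have hb := hnorm.mul_left (|r| ^ m)
  refine hmain.norm_le_of_bounded hb fun n => ?_
  rcases lt_or_ge n m with hn | hn
  · rw [hc, hm n hn]; simp
  · rw [Real.norm_eq_abs, abs_mul, abs_mul, abs_pow, ← mul_assoc, abs_mul_abs_self, mul_comm]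
    exact mul_le_mul_of_nonneg_right (pow_le_pow_of_le_one (abs_nonneg _) hr hn)
      (mul_self_nonneg _)

end IsStdGaussianPair

/-! ### Second moments of path means -/

/-- The mean of the first `n` values of `f` along the path `Y`. -/
noncomputable def pathMean {Ω : Type*} (Y : ℕ → Ω → ℝ) (f : ℝ → ℝ) (n : ℕ) (ω : Ω) : ℝ :=
  (1 / (n : ℝ)) * ∑ i ∈ Finset.range n, f (Y i ω)

/-- With truncated subtraction `(i - j) + (j - i)` is the distance |i - j|, and each lag is attained
by at most 2n pairs. -/
theorem sum_sum_lag_le {a : ℕ → ℝ} (ha : ∀ k, 0 ≤ a k) (n : ℕ) :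
    ∑ i ∈ Finset.range n, ∑ j ∈ Finset.range n, a ((i - j) + (j - i)) ≤
      2 * n * ∑ k ∈ Finset.range n, a k := by
  induction n with
  | zero => simp
  | succ n ih =>
    have h1 : ∑ j ∈ Finset.range n, a ((n - j) + (j - n)) = ∑ k ∈ Finset.range n, a (k + 1) := by
      rw [← Finset.sum_range_reflect]
      refine Finset.sum_congr rfl fun j hj => ?_
      have := Finset.mem_range.1 hj
      congr 1; omega
    have h2 : ∑ i ∈ Finset.range n, a ((i - n) + (n - i)) = ∑ k ∈ Finset.range n, a (k + 1) := by
      rw [← h1]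
      exact Finset.sum_congr rfl fun j _ => by rw [add_comm]
    simp only [Finset.sum_range_succ _ n, Finset.sum_add_distrib]
    rw [h1, h2]
    have h3 := Finset.sum_range_succ' a n
    rw [Finset.sum_range_succ] at h3
    have h4 := ha 0
    have h5 := ha n
    have h6 : 0 ≤ ∑ k ∈ Finset.range n, a (k + 1) := Finset.sum_nonneg fun k _ => ha _
    have h7 : (0 : ℝ) ≤ n * a n := by positivity
    simp only [tsub_self, add_zero]
    push_cast
    nlinarith

namespace IsStationaryGaussian

variable {Ω : Type*} [MeasurableSpace Ω] {P : Measure Ω} {Y : ℕ → Ω → ℝ} {ρ : ℕ → ℝ}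

theorem map_eq (hY : IsStationaryGaussian P Y ρ) (i : ℕ) : P.map (Y i) = gaussianReal 0 1 := by
  rw [(hY.isGaussianProcess.hasGaussianLaw_eval i).map_eq_gaussianReal, hY.centered,
    hY.variance_eq_one]
  simp

theorem isStdGaussianPair (hY : IsStationaryGaussian P Y ρ) (i j : ℕ) :
    IsStdGaussianPair P (Y i) (Y j) (ρ ((i - j) + (j - i))) where
  hasGaussianLaw := hY.isGaussianProcess.hasGaussianLaw_prodMk
  map_fst := hY.map_eq i
  map_snd := hY.map_eq j
  covariance_eq := by
    rcases le_total i j with h | h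
    · obtain ⟨k, rfl⟩ := Nat.exists_eq_add_of_le h
      rw [hY.covariance_eq i k]; congr 1; omega
    · obtain ⟨k, rfl⟩ := Nat.exists_eq_add_of_le h
      rw [covariance_comm, hY.covariance_eq j k]; congr 1; omega

theorem memLp_comp (hY : IsStationaryGaussian P Y ρ) {f : ℝ → ℝ} {q : ENNReal}
    (hf : MemLp f q (gaussianReal 0 1)) (i : ℕ) : MemLp (fun ω => f (Y i ω)) q P := by
  rw [← hY.map_eq i] at hf
  exact hf.comp_of_map (hY.isGaussianProcess.aemeasurable i)

theorem memLp_pathMean (hY : IsStationaryGaussian P Y ρ) {f : ℝ → ℝ} {q : ENNReal}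
    (hf : MemLp f q (gaussianReal 0 1)) (n : ℕ) : MemLp (pathMean Y f n) q P :=
  (memLp_finsetSum _ fun i _ => hY.memLp_comp hf i).const_mul _

theorem integral_pathMean (hY : IsStationaryGaussian P Y ρ) {f : ℝ → ℝ}
    (hf : Integrable f (gaussianReal 0 1)) {n : ℕ} (hn : n ≠ 0) :
    ∫ ω, pathMean Y f n ω ∂P = ∫ x, f x ∂(gaussianReal 0 1) := by
  have hi (i : ℕ) : ∫ ω, f (Y i ω) ∂P = ∫ x, f x ∂(gaussianReal 0 1) := by
    rw [← hY.map_eq i, integral_map (hY.isGaussianProcess.aemeasurable i)]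
    rw [hY.map_eq i]; exact hf.1
  have hn' : (n : ℝ) ≠ 0 := by exact_mod_cast hn
  simp only [pathMean]
  rw [integral_const_mul, integral_finsetSum _ fun i _ => memLp_one_iff_integrable.1
    (hY.memLp_comp (memLp_one_iff_integrable.2 hf) i)]
  simp only [hi, Finset.sum_const, Finset.card_range, nsmul_eq_mul]
  field_simp

/-- The second moment of a path mean of a function whose Hermite coefficients of index less
than `m` vanish. -/
theorem integral_sq_pathMean_le (hY : IsStationaryGaussian P Y ρ) {f : ℝ → ℝ}
    (hf : MemLp f 2 (gaussianReal 0 1)) {m : ℕ} (hm : ∀ j < m, hermiteCoeff f j = 0) (n : ℕ) :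
    ∫ ω, pathMean Y f n ω ^ 2 ∂P ≤ 2 * (∫ x, f x ^ 2 ∂(gaussianReal 0 1)) *
      ((1 / (n : ℝ)) * ∑ k ∈ Finset.range n, |ρ k| ^ m) := by
  set C := ∫ x, f x ^ 2 ∂(gaussianReal 0 1)
  have hC : 0 ≤ C := integral_nonneg fun x => sq_nonneg _
  have hint (i j : ℕ) : Integrable (fun ω => f (Y i ω) * f (Y j ω)) P :=
    (hY.memLp_comp hf i).integrable_mul (hY.memLp_comp hf j)
  have e : ∫ ω, pathMean Y f n ω ^ 2 ∂P = (1 / (n : ℝ)) ^ 2 *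
      ∑ i ∈ Finset.range n, ∑ j ∈ Finset.range n, ∫ ω, f (Y i ω) * f (Y j ω) ∂P := by
    have : ∀ ω, pathMean Y f n ω ^ 2 = (1 / (n : ℝ)) ^ 2 *
        ∑ i ∈ Finset.range n, ∑ j ∈ Finset.range n, f (Y i ω) * f (Y j ω) := by
      intro ω
      rw [pathMean, mul_pow, sq (∑ i ∈ Finset.range n, f (Y i ω)), Finset.sum_mul_sum]
    simp only [this]
    rw [integral_const_mul, integral_finsetSum _ fun i _ =>
      integrable_finsetSum _ fun j _ => hint i j]
    congr 1
    exact Finset.sum_congr rfl fun i _ => integral_finsetSum _ fun j _ => hint i j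
  have hb : ∑ i ∈ Finset.range n, ∑ j ∈ Finset.range n, ∫ ω, f (Y i ω) * f (Y j ω) ∂P ≤
      (2 * n * ∑ k ∈ Finset.range n, |ρ k| ^ m) * C := by
    refine le_trans ?_ (mul_le_mul_of_nonneg_right
      (sum_sum_lag_le (a := fun k => |ρ k| ^ m) (fun k => by positivity) n) hC)
    rw [Finset.sum_mul]
    refine Finset.sum_le_sum fun i _ => ?_
    rw [Finset.sum_mul]
    exact Finset.sum_le_sum fun j _ =>
      (le_abs_self _).trans ((hY.isStdGaussianPair i j).abs_integral_mul_le hf hm)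
  rw [e]
  refine (mul_le_mul_of_nonneg_left hb (by positivity)).trans_eq ?_
  rcases eq_or_ne n 0 with rfl | hn
  · simp
  · have hn' : (n : ℝ) ≠ 0 := by exact_mod_cast hn
    field_simp

end IsStationaryGaussian

/-! ### Correlation decay and the rate -/

section Rate

variable {ρ : ℕ → ℝ} {κ α : ℝ}

theorem exists_abs_le_mul_rpow (hα : 0 < α)
    (hρ : Tendsto (fun i : ℕ => ρ i * (i : ℝ) ^ α) atTop (𝓝 κ)) :
    ∃ D, 0 ≤ D ∧ ∀ k : ℕ, |ρ k| ≤ D * ((k : ℝ) + 1) ^ (-α) := by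
  obtain ⟨M, hM⟩ := hρ.abs.bddAbove_range
  have hM' (k : ℕ) : |ρ k| * (k : ℝ) ^ α ≤ M := by
    have := hM ⟨k, rfl⟩
    simpa [abs_mul, abs_of_nonneg (Real.rpow_nonneg (Nat.cast_nonneg k) α)] using this
  -- The first entry covers `k = 0`; for `k ≥ 1` the factor `2 ^ α` pays for replacing `k` by `k + 1
  -- ≤ 2k`.
  refine ⟨max |ρ 0| (M * 2 ^ α), le_max_of_le_left (abs_nonneg _), fun k => ?_⟩
  have hk : (0 : ℝ) < (k : ℝ) + 1 := by positivity
  rw [Real.rpow_neg hk.le, ← div_eq_mul_inv, le_div_iff₀ (Real.rpow_pos_of_pos hk α)]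
  rcases Nat.eq_zero_or_pos k with rfl | hpos
  · simp
  · refine le_max_of_le_right ?_
    have h1 : (1 : ℝ) ≤ k := by exact_mod_cast hpos
    have h2 : ((k : ℝ) + 1) ^ α ≤ 2 ^ α * (k : ℝ) ^ α := by
      rw [← Real.mul_rpow (by norm_num) (by positivity)]
      exact Real.rpow_le_rpow hk.le (by linarith) hα.le
    calc |ρ k| * ((k : ℝ) + 1) ^ α ≤ |ρ k| * (2 ^ α * (k : ℝ) ^ α) := by gcongr
      _ = (|ρ k| * (k : ℝ) ^ α) * 2 ^ α := by ring
      _ ≤ M * 2 ^ α := by gcongr; exact hM' k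

theorem tendsto_zero_of_tendsto_mul_rpow (hα : 0 < α)
    (hρ : Tendsto (fun i : ℕ => ρ i * (i : ℝ) ^ α) atTop (𝓝 κ)) : Tendsto ρ atTop (𝓝 0) := by
  have h1 : Tendsto (fun i : ℕ => (i : ℝ) ^ (-α)) atTop (𝓝 0) :=
    (tendsto_rpow_neg_atTop hα).comp tendsto_natCast_atTop_atTop
  have h2 := hρ.mul h1
  rw [mul_zero] at h2
  refine h2.congr' ?_
  filter_upwards [eventually_gt_atTop 0] with i hi
  have hi' : (0 : ℝ) < i := by exact_mod_cast hi
  rw [mul_assoc, ← Real.rpow_add hi']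
  simp

/-- Each increment of n^(1-s) dominates the new term, by Bernoulli's inequality for the exponent 1 -
s ≤ 1 at -1/(n + 1). -/
theorem sum_add_one_rpow_neg_le {s : ℝ} (hs0 : 0 ≤ s) (hs1 : s < 1) (n : ℕ) :
    (1 - s) * ∑ k ∈ Finset.range n, ((k : ℝ) + 1) ^ (-s) ≤ (n : ℝ) ^ (1 - s) := by
  induction n with
  | zero => simp [Real.zero_rpow (by linarith : 1 - s ≠ 0)]
  | succ n ih =>
    have hn : (0 : ℝ) < (n : ℝ) + 1 := by positivity
    have hB := rpow_one_add_le_one_add_mul_self (s := -1 / ((n : ℝ) + 1)) (p := 1 - s)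
      (by rw [le_div_iff₀ hn]; linarith [(Nat.cast_nonneg n : (0 : ℝ) ≤ n)])
      (by linarith) (by linarith)
    have e1 : (1 : ℝ) + -1 / ((n : ℝ) + 1) = n / ((n : ℝ) + 1) := by field_simp; ring
    rw [e1, Real.div_rpow (Nat.cast_nonneg n) hn.le,
      div_le_iff₀ (Real.rpow_pos_of_pos hn _)] at hB
    have e2 : ((n : ℝ) + 1) ^ (1 - s) = ((n : ℝ) + 1) * ((n : ℝ) + 1) ^ (-s) := by
      rw [sub_eq_add_neg, Real.rpow_add hn, Real.rpow_one]
    have e3 : (1 + (1 - s) * (-1 / ((n : ℝ) + 1))) * ((n : ℝ) + 1) ^ (1 - s) =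
        ((n : ℝ) + 1) ^ (1 - s) - (1 - s) * ((n : ℝ) + 1) ^ (-s) := by
      rw [e2]; field_simp; ring
    rw [Finset.sum_range_succ, mul_add]
    push_cast
    linarith

theorem rate_pos (α : ℝ) (τ : ℕ) {n : ℕ} (hn : 2 ≤ n) : 0 < rate α τ n := by
  have h1 : (1 : ℝ) < n := by exact_mod_cast hn
  have h0 : (0 : ℝ) < n := by linarith
  have := Real.log_pos h1
  unfold rate
  split_ifs <;> positivity

/-- The Cesàro means of `|ρ| ^ τ` are of the order of the squared rate. -/
theorem exists_mean_abs_pow_le_rate_sq (hα : 0 < α)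
    (hρ : Tendsto (fun i : ℕ => ρ i * (i : ℝ) ^ α) atTop (𝓝 κ)) (τ : ℕ) :
    ∃ C, 0 ≤ C ∧ ∀ᶠ n : ℕ in atTop,
      (1 / (n : ℝ)) * ∑ k ∈ Finset.range n, |ρ k| ^ τ ≤ C * rate α τ n ^ 2 := by
  obtain ⟨D, hD0, hD⟩ := exists_abs_le_mul_rpow hα hρ
  have hs0 : 0 ≤ α * τ := by positivity
  have hterm (k : ℕ) : |ρ k| ^ τ ≤ D ^ τ * ((k : ℝ) + 1) ^ (-(α * τ)) := by
    have hk : (0 : ℝ) ≤ (k : ℝ) + 1 := by positivity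
    calc |ρ k| ^ τ ≤ (D * ((k : ℝ) + 1) ^ (-α)) ^ τ := by gcongr; exact hD k
      _ = _ := by rw [mul_pow, ← Real.rpow_mul_natCast hk]; ring_nf
  have hsum (n : ℕ) : ∑ k ∈ Finset.range n, |ρ k| ^ τ ≤
      D ^ τ * ∑ k ∈ Finset.range n, ((k : ℝ) + 1) ^ (-(α * τ)) := by
    rw [Finset.mul_sum]; exact Finset.sum_le_sum fun k _ => hterm k
  have hDτ : 0 ≤ D ^ τ := by positivity
  have hhalf {n : ℕ} (hn : (0 : ℝ) < n) : ((n : ℝ) ^ (-(1 / 2) : ℝ)) ^ 2 = 1 / n := by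
    rw [← Real.rpow_mul_natCast hn.le]
    norm_num [Real.rpow_neg_one]
  unfold rate
  split_ifs with h1 h2
  · have hS : Summable fun k : ℕ => ((k : ℝ) + 1) ^ (-(α * τ)) := by
      have := (summable_nat_add_iff 1).2 (Real.summable_nat_rpow (p := -(α * τ)).2 (by linarith))
      simpa using this
    refine ⟨D ^ τ * ∑' k : ℕ, ((k : ℝ) + 1) ^ (-(α * τ)),
      mul_nonneg hDτ (tsum_nonneg fun k => by positivity), ?_⟩
    filter_upwards [eventually_gt_atTop 0] with n hn
    rw [hhalf (by exact_mod_cast hn), mul_comm]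
    refine mul_le_mul_of_nonneg_right ((hsum n).trans ?_) (by positivity)
    exact mul_le_mul_of_nonneg_left (hS.sum_le_tsum _ fun k _ => by positivity) hDτ
  · refine ⟨D ^ τ * 2, by positivity, ?_⟩
    -- From 3 on `log n ≥ 1`, so the harmonic bound `1 + log n` is at most `2 * (log n) ^ 2`, the
    -- source of the factor 2.
    filter_upwards [eventually_ge_atTop 3] with n hn
    have hn' : (3 : ℝ) ≤ n := by exact_mod_cast hn
    have hlog : 1 ≤ Real.log n := by
      rw [Real.le_log_iff_exp_le (by linarith)]
      linarith [Real.exp_one_lt_d9]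
    rw [mul_pow, hhalf (by linarith), mul_comm (1 / (n : ℝ)), mul_comm (1 / (n : ℝ)), ← mul_assoc]
    refine mul_le_mul_of_nonneg_right ((hsum n).trans ?_) (by positivity)
    rw [mul_assoc]
    refine mul_le_mul_of_nonneg_left ?_ hDτ
    have hh := harmonic_le_one_add_log n
    have e : ((harmonic n : ℚ) : ℝ) = ∑ k ∈ Finset.range n, ((k : ℝ) + 1) ^ (-(α * τ)) := by
      rw [harmonic, h2]
      push_cast
      exact Finset.sum_congr rfl fun k _ => by rw [Real.rpow_neg_one]
    rw [← e]
    nlinarith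
  · have hs1 : α * τ < 1 := lt_of_le_of_ne (not_lt.1 h1) h2
    have hpos : 0 < 1 - α * τ := by linarith
    refine ⟨D ^ τ / (1 - α * τ), by positivity, ?_⟩
    filter_upwards [eventually_gt_atTop 0] with n hn
    have hn' : (0 : ℝ) < n := by exact_mod_cast hn
    have hb := sum_add_one_rpow_neg_le hs0 hs1 n
    rw [mul_comm, ← le_div_iff₀ hpos] at hb
    have e : ((n : ℝ) ^ (-(α * τ) / 2)) ^ 2 = (1 / (n : ℝ)) * (n : ℝ) ^ (1 - α * τ) := by
      rw [← Real.rpow_mul_natCast hn'.le, one_div, ← Real.rpow_neg_one, ← Real.rpow_add hn']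
      congr 1; push_cast; ring
    rw [e]
    calc (1 / (n : ℝ)) * ∑ k ∈ Finset.range n, |ρ k| ^ τ
        ≤ (1 / (n : ℝ)) * (D ^ τ * ((n : ℝ) ^ (1 - α * τ) / (1 - α * τ))) := by
          refine mul_le_mul_of_nonneg_left ((hsum n).trans ?_) (by positivity)
          exact mul_le_mul_of_nonneg_left hb hDτ
      _ = _ := by ring

end Rate

/-! ### The score of one observation -/

section Score

variable {p z θ : ℝ}

theorem weight_of_le (hp1 : p ≤ 1) (h : z ≤ θ) : weight p z θ = 1 - p := by
  rw [weight, if_pos h, abs_of_nonpos (by linarith)]; ring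

theorem weight_of_lt (hp0 : 0 ≤ p) (h : θ < z) : weight p z θ = p := by
  rw [weight, if_neg (not_le.2 h), sub_zero, abs_of_nonneg hp0]

theorem min_le_weight (hp0 : 0 ≤ p) (hp1 : p ≤ 1) : min p (1 - p) ≤ weight p z θ := by
  rcases le_or_gt z θ with h | h
  · rw [weight_of_le hp1 h]; exact min_le_right _ _
  · rw [weight_of_lt hp0 h]; exact min_le_left _ _

theorem weight_le_one (hp0 : 0 ≤ p) (hp1 : p ≤ 1) : weight p z θ ≤ 1 := by
  rcases le_or_gt z θ with h | h
  · rw [weight_of_le hp1 h]; linarith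
  · rw [weight_of_lt hp0 h]; exact hp1

theorem weight_nonneg : 0 ≤ weight p z θ := abs_nonneg _

/-- The jump of the weight sits where `z - θ` vanishes; this form makes the score visibly Lipschitz
in `θ`. -/
theorem weight_mul_sub (hp0 : 0 ≤ p) (hp1 : p ≤ 1) :
    weight p z θ * (z - θ) = p * (z - θ) + (2 * p - 1) * max (θ - z) 0 := by
  rcases le_or_gt z θ with h | h
  · rw [weight_of_le hp1 h, max_eq_left (by linarith)]; ring
  · rw [weight_of_lt hp0 h, max_eq_right (by linarith)]; ring

/-- Strong convexity of one summand: its curvature is twice the weight, hence at least `2 * min p (1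
- p)`. When `z` separates `θ` from `θ'`, the product `(z - θ) * (z - θ')` is nonpositive. -/
theorem weight_mul_sq_ge (hp0 : 0 ≤ p) (hp1 : p ≤ 1) (z θ θ' : ℝ) :
    weight p z θ * (z - θ) ^ 2 - 2 * (weight p z θ * (z - θ)) * (θ' - θ) +
      min p (1 - p) * (θ' - θ) ^ 2 ≤ weight p z θ' * (z - θ') ^ 2 := by
  set c := min p (1 - p)
  have hcp : c ≤ p := min_le_left _ _
  have hcq : c ≤ 1 - p := min_le_right _ _
  have hc : 0 ≤ c := le_min hp0 (by linarith)
  have hd : θ' - θ = (z - θ) - (z - θ') := by ring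
  rw [hd]
  rcases le_or_gt z θ with h | h <;> rcases le_or_gt z θ' with h' | h'
  · rw [weight_of_le hp1 h, weight_of_le hp1 h']
    nlinarith [mul_nonneg (sub_nonneg.2 hcq) (sq_nonneg ((z - θ) - (z - θ')))]
  · rw [weight_of_le hp1 h, weight_of_lt hp0 h']
    have h1 : 0 ≤ -((z - θ) * (z - θ')) := by nlinarith
    nlinarith [mul_nonneg (sub_nonneg.2 hcq) h1, mul_nonneg (sub_nonneg.2 hcq) (sq_nonneg (z - θ)),
      mul_nonneg (sub_nonneg.2 hcp) (sq_nonneg (z - θ'))]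
  · rw [weight_of_lt hp0 h, weight_of_le hp1 h']
    have h1 : 0 ≤ -((z - θ) * (z - θ')) := by nlinarith
    nlinarith [mul_nonneg (sub_nonneg.2 hcp) h1, mul_nonneg (sub_nonneg.2 hcp) (sq_nonneg (z - θ)),
      mul_nonneg (sub_nonneg.2 hcq) (sq_nonneg (z - θ'))]
  · rw [weight_of_lt hp0 h, weight_of_lt hp0 h']
    nlinarith [mul_nonneg (sub_nonneg.2 hcp) (sq_nonneg ((z - θ) - (z - θ')))]

theorem abs_max_sub_max_le (a b : ℝ) : |max a 0 - max b 0| ≤ |a - b| :=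
  abs_max_sub_max_le_abs a b 0

theorem abs_weight_mul_sub_sub_le (hp0 : 0 ≤ p) (hp1 : p ≤ 1) (z θ θ' : ℝ) :
    |weight p z θ * (z - θ) - weight p z θ' * (z - θ')| ≤ 2 * |θ - θ'| := by
  rw [weight_mul_sub hp0 hp1, weight_mul_sub hp0 hp1]
  have h1 := abs_max_sub_max_le (θ - z) (θ' - z)
  rw [show θ - z - (θ' - z) = θ - θ' by ring] at h1
  have h2 : |2 * p - 1| ≤ 1 := abs_le.2 ⟨by linarith, by linarith⟩
  calc _ = |-(p * (θ - θ')) + (2 * p - 1) * (max (θ - z) 0 - max (θ' - z) 0)| := by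
        congr 1; ring
    _ ≤ |-(p * (θ - θ'))| + |(2 * p - 1) * (max (θ - z) 0 - max (θ' - z) 0)| := abs_add_le _ _
    _ ≤ 1 * |θ - θ'| + 1 * |θ - θ'| := by
        rw [abs_neg, abs_mul, abs_mul, abs_of_nonneg hp0]
        gcongr
    _ = _ := by ring

/-- First order expansion of the score in the location parameter. -/
theorem abs_score_expansion_le (hp0 : 0 ≤ p) (hp1 : p ≤ 1) (z θ θ' : ℝ) {δ : ℝ}
    (hδ : |θ' - θ| ≤ δ) :
    |weight p z θ' * (z - θ') - weight p z θ * (z - θ) + (θ' - θ) * weight p z θ| ≤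
      |θ' - θ| * (|2 * p - 1| * {y : ℝ | |y - θ| ≤ δ}.indicator 1 z) := by
  have hw : weight p z θ = p - (2 * p - 1) * (if z ≤ θ then 1 else 0) := by
    split_ifs with h
    · rw [weight_of_le hp1 h]; ring
    · rw [weight_of_lt hp0 (not_le.1 h)]; ring
  have e : weight p z θ' * (z - θ') - weight p z θ * (z - θ) + (θ' - θ) * weight p z θ =
      (2 * p - 1) * (max (θ' - z) 0 - max (θ - z) 0 - (θ' - θ) * (if z ≤ θ then 1 else 0)) := by
    rw [weight_mul_sub hp0 hp1, weight_mul_sub hp0 hp1, hw]; ring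
  rw [e, abs_mul, mul_left_comm]
  refine mul_le_mul_of_nonneg_left ?_ (abs_nonneg _)
  by_cases hz : |z - θ| ≤ δ
  · rw [Set.indicator_of_mem (by exact hz), Pi.one_apply, mul_one]
    rcases le_or_gt z θ with h | h
    · rw [if_pos h, max_eq_left (a := θ - z) (by linarith)]
      rcases le_total (θ' - z) 0 with h' | h'
      · rw [max_eq_right h', abs_le]
        have := neg_abs_le (θ' - θ)
        exact ⟨by linarith [abs_nonneg (θ' - θ)], by linarith⟩
      · rw [max_eq_left h']
        ring_nf; simp
    · rw [if_neg (not_le.2 h), mul_zero, sub_zero]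
      refine (abs_max_sub_max_le _ _).trans_eq ?_
      congr 1; ring
  -- Here `θ` and `θ'` lie on the same side of `z`, where the score is affine and the expansion
  -- exact.
  · rw [Set.indicator_of_notMem (by exact hz), mul_zero]
    have hz' : |θ' - θ| < |z - θ| := hδ.trans_lt (not_le.1 hz)
    rw [abs_lt] at hz'
    refine le_of_eq (abs_eq_zero.2 ?_)
    rcases le_or_gt z θ with h | h
    · rw [abs_of_nonpos (sub_nonpos.2 h)] at hz'
      rw [if_pos h, max_eq_left (by linarith), max_eq_left (by linarith)]; ring
    · rw [abs_of_pos (sub_pos.2 h)] at hz'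
      rw [if_neg (not_le.2 h), max_eq_right (by linarith), max_eq_right (by linarith)]; ring

end Score

/-! ### Minimisers of strongly convex criteria -/

section Argmin

variable {f ψ : ℝ → ℝ} {c : ℝ}

/-- `ψ` is minus half the derivative of the criterion `f`, which is `2c`-strongly convex. -/
def IsScoreOf (ψ f : ℝ → ℝ) (c : ℝ) : Prop :=
  ∀ θ θ', f θ - 2 * ψ θ * (θ' - θ) + c * (θ' - θ) ^ 2 ≤ f θ'

/-- Adding the convexity inequality to itself with the two points exchanged cancels the criterion.
-/
theorem IsScoreOf.mul_sq_le (H : IsScoreOf ψ f c) (θ θ' : ℝ) :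
    c * (θ' - θ) ^ 2 ≤ (ψ θ - ψ θ') * (θ' - θ) := by
  have h1 := H θ θ'
  have h2 := H θ' θ
  nlinarith

theorem IsScoreOf.mul_abs_le (H : IsScoreOf ψ f c) (θ θ' : ℝ) :
    c * |θ' - θ| ≤ |ψ θ - ψ θ'| := by
  rcases eq_or_ne θ' θ with rfl | hne
  · simp
  · have hpos : 0 < |θ' - θ| := abs_pos.2 (sub_ne_zero.2 hne)
    have h := (H.mul_sq_le θ θ').trans (le_abs_self _)
    rw [abs_mul, ← sq_abs] at h
    exact le_of_mul_le_mul_right (by linarith) hpos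

/-- By strong monotonicity, a step of `ψ 0 / c` away from 0 is long enough for `ψ` to reach the
opposite sign or zero. -/
theorem IsScoreOf.exists_eq_zero (hc : 0 < c) (hψ : Continuous ψ) (H : IsScoreOf ψ f c) :
    ∃ θ, ψ θ = 0 := by
  have hkey (θ : ℝ) (hθ : θ = ψ 0 / c) : ψ θ * ψ 0 ≤ 0 := by
    have h := H.mul_sq_le 0 θ
    rw [sub_zero] at h
    have hψ0 : ψ 0 = c * θ := by rw [hθ]; field_simp
    rw [hψ0] at h ⊢
    nlinarith
  have hz := hkey _ rfl
  rcases le_total 0 (ψ 0) with h0 | h0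
  · rcases h0.eq_or_lt with h0 | h0
    · exact ⟨0, h0.symm⟩
    · have : ψ (ψ 0 / c) ≤ 0 := by nlinarith
      exact mem_range_of_exists_le_of_exists_ge hψ ⟨_, this⟩ ⟨0, h0.le⟩
  · rcases h0.eq_or_lt with h0 | h0
    · exact ⟨0, h0⟩
    · have : 0 ≤ ψ (ψ 0 / c) := by nlinarith
      exact mem_range_of_exists_le_of_exists_ge hψ ⟨0, h0.le⟩ ⟨_, this⟩

/-- The choice in `argmin` is meaningful once a minimiser exists: a zero of the score is one, and
strong convexity makes it the only one. -/
theorem IsScoreOf.argmin_eq_zero (hc : 0 < c) (hψ : Continuous ψ) (H : IsScoreOf ψ f c) :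
    ψ (argmin f) = 0 := by
  obtain ⟨θ, hθ⟩ := H.exists_eq_zero hc hψ
  have hmin : ∃ θ, ∀ θ', f θ ≤ f θ' := by
    refine ⟨θ, fun θ' => ?_⟩
    have h := H θ θ'
    rw [hθ] at h
    nlinarith [mul_nonneg hc.le (sq_nonneg (θ' - θ))]
  have h1 := Classical.epsilon_spec hmin θ
  have h2 := H θ (argmin f)
  rw [hθ] at h2
  have h3 : c * (argmin f - θ) ^ 2 ≤ 0 := by
    have : f (argmin f) ≤ f θ := h1
    linarith
  have h4 : argmin f - θ = 0 := by
    by_contra hne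
    have : 0 < c * (argmin f - θ) ^ 2 := by positivity
    linarith
  rw [sub_eq_zero.1 h4, hθ]

end Argmin

/-! ### The sample expectile -/

section Sample

variable {p : ℝ} {n : ℕ} {z : ℕ → ℝ}

theorem isScoreOf_samplePsi (hp0 : 0 ≤ p) (hp1 : p ≤ 1) (hn : n ≠ 0) (z : ℕ → ℝ) :
    IsScoreOf (samplePsi n z p)
      (fun θ => (1 / (n : ℝ)) * ∑ i ∈ Finset.range n, weight p (z i) θ * (z i - θ) ^ 2)
      (min p (1 - p)) := by
  intro θ θ'
  have hn' : (n : ℝ) ≠ 0 := by exact_mod_cast hn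
  have h := Finset.sum_le_sum fun i (_ : i ∈ Finset.range n) => weight_mul_sq_ge hp0 hp1 (z i) θ θ'
  have h2 := mul_le_mul_of_nonneg_left h (by positivity : (0 : ℝ) ≤ 1 / n)
  refine le_of_eq_of_le ?_ h2
  simp only [samplePsi, Finset.sum_add_distrib, Finset.sum_sub_distrib, ← Finset.sum_mul,
    ← Finset.mul_sum, Finset.sum_const, Finset.card_range, nsmul_eq_mul]
  field_simp

theorem continuous_weight_mul_sub (hp0 : 0 ≤ p) (hp1 : p ≤ 1) (z : ℝ) :
    Continuous fun θ => weight p z θ * (z - θ) := by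
  simp only [weight_mul_sub hp0 hp1]
  fun_prop

theorem samplePsi_sampleExpectile (hp0 : 0 < p) (hp1 : p < 1) (hn : n ≠ 0) (z : ℕ → ℝ) :
    samplePsi n z p (sampleExpectile n z p) = 0 :=
  (isScoreOf_samplePsi hp0.le hp1.le hn z).argmin_eq_zero (lt_min hp0 (by linarith))
    (continuous_const.mul (continuous_finsetSum _ fun i _ =>
      continuous_weight_mul_sub hp0.le hp1.le (z i)))

theorem mul_abs_sampleExpectile_sub_le (hp0 : 0 < p) (hp1 : p < 1) (hn : n ≠ 0) (z : ℕ → ℝ)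
    (θ : ℝ) : min p (1 - p) * |sampleExpectile n z p - θ| ≤ |samplePsi n z p θ| := by
  have h := (isScoreOf_samplePsi hp0.le hp1.le hn z).mul_abs_le θ (sampleExpectile n z p)
  rwa [samplePsi_sampleExpectile hp0 hp1 hn z, sub_zero] at h

end Sample

/-! ### The population score and the absence of an atom -/

section Population

variable {p : ℝ} {h : ℝ → ℝ}

theorem measurable_weight (hh : Measurable h) (p θ : ℝ) : Measurable fun t => weight p (h t) θ := by
  unfold weight
  have : Measurable fun t => if h t ≤ θ then (1 : ℝ) else 0 :=
    Measurable.ite (measurableSet_le hh measurable_const) measurable_const measurable_const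
  simpa [Real.norm_eq_abs] using (this.const_sub p).norm

theorem norm_weight_le_one (hp0 : 0 ≤ p) (hp1 : p ≤ 1) (z θ : ℝ) : ‖weight p z θ‖ ≤ 1 := by
  rw [Real.norm_of_nonneg weight_nonneg]; exact weight_le_one hp0 hp1

theorem memLp_weight (hh : Measurable h) (hp0 : 0 ≤ p) (hp1 : p ≤ 1) (θ : ℝ) (q : ENNReal) :
    MemLp (fun t => weight p (h t) θ) q (gaussianReal 0 1) :=
  MemLp.of_bound (measurable_weight hh p θ).aestronglyMeasurable 1
    (ae_of_all _ fun _ => norm_weight_le_one hp0 hp1 _ _)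

theorem memLp_score (hh : Measurable h) (h2 : MemLp h 2 (gaussianReal 0 1)) (hp0 : 0 ≤ p)
    (hp1 : p ≤ 1) (θ : ℝ) :
    MemLp (fun t => weight p (h t) θ * (h t - θ)) 2 (gaussianReal 0 1) := by
  refine (h2.sub (memLp_const θ)).of_le
    ((measurable_weight hh p θ).mul (hh.sub_const θ)).aestronglyMeasurable (ae_of_all _ fun t => ?_)
  rw [norm_mul]
  exact mul_le_of_le_one_left (norm_nonneg _) (norm_weight_le_one hp0 hp1 _ _)

theorem integrable_weight_mul_sq (hh : Measurable h) (h2 : MemLp h 2 (gaussianReal 0 1))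
    (hp0 : 0 ≤ p) (hp1 : p ≤ 1) (θ : ℝ) :
    Integrable (fun t => weight p (h t) θ * (h t - θ) ^ 2) (gaussianReal 0 1) := by
  refine ((memLp_score hh h2 hp0 hp1 θ).integrable_mul (h2.sub (memLp_const θ))).congr
    (ae_of_all _ fun t => ?_)
  simp only [Pi.mul_apply, Pi.sub_apply]; ring

theorem isScoreOf_psi (hh : Measurable h) (h2 : MemLp h 2 (gaussianReal 0 1)) (hp0 : 0 ≤ p)
    (hp1 : p ≤ 1) :
    IsScoreOf (psi h p) (fun θ => ∫ t, weight p (h t) θ * (h t - θ) ^ 2 ∂(gaussianReal 0 1))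
      (min p (1 - p)) := by
  intro θ θ'
  have i1 := integrable_weight_mul_sq hh h2 hp0 hp1 θ
  have i2 := (memLp_score hh h2 hp0 hp1 θ).integrable one_le_two
  have i3 : Integrable (fun t => 2 * (weight p (h t) θ * (h t - θ)) * (θ' - θ))
    (gaussianReal 0 1) := (i2.const_mul 2).mul_const _
  have i4 : Integrable (fun _ : ℝ => min p (1 - p) * (θ' - θ) ^ 2) (gaussianReal 0 1) :=
    integrable_const _
  have hm := integral_mono ((i1.sub i3).add i4) (integrable_weight_mul_sq hh h2 hp0 hp1 θ')
    fun t => weight_mul_sq_ge hp0 hp1 (h t) θ θ'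
  refine le_of_eq_of_le ?_ hm
  rw [integral_add' (i1.sub i3) i4, integral_sub' i1 i3, integral_mul_const, integral_const_mul]
  simp [psi]

theorem continuous_psi (hh : Measurable h) (h2 : MemLp h 2 (gaussianReal 0 1)) (hp0 : 0 ≤ p)
    (hp1 : p ≤ 1) : Continuous (psi h p) := by
  refine (LipschitzWith.of_dist_le_mul (K := 2) fun θ θ' => ?_).continuous
  have i (θ : ℝ) := (memLp_score hh h2 hp0 hp1 θ).integrable one_le_two
  rw [Real.dist_eq, psi, psi, ← integral_sub (i θ) (i θ')]
  have hb (t : ℝ) : ‖weight p (h t) θ * (h t - θ) - weight p (h t) θ' * (h t - θ')‖ ≤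
      2 * |θ - θ'| := abs_weight_mul_sub_sub_le hp0 hp1 (h t) θ θ'
  refine (norm_integral_le_of_norm_le_const (ae_of_all (gaussianReal 0 1) hb)).trans_eq ?_
  simp [Real.dist_eq]

theorem psi_expectile (hh : Measurable h) (h2 : MemLp h 2 (gaussianReal 0 1)) (hp0 : 0 < p)
    (hp1 : p < 1) : psi h p (expectile h p) = 0 :=
  (isScoreOf_psi hh h2 hp0.le hp1.le).argmin_eq_zero (lt_min hp0 (by linarith))
    (continuous_psi hh h2 hp0.le hp1.le)

theorem min_le_neg_psi' (hh : Measurable h) (hp0 : 0 ≤ p) (hp1 : p ≤ 1) (θ : ℝ) :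
    min p (1 - p) ≤ -psi' h p θ := by
  rw [psi', neg_neg]
  have := integral_mono (integrable_const (μ := gaussianReal 0 1) (min p (1 - p)))
    ((memLp_weight hh hp0 hp1 θ 1).integrable le_rfl) fun t => min_le_weight (z := h t) hp0 hp1
  simpa using this

/-- Differentiability of `psi` at `θ` excludes an atom of `h(Y)` at `θ`, unless `p = 1 / 2`. -/
theorem abs_mul_measureReal_eq_zero (hh : Measurable h) (h2 : MemLp h 2 (gaussianReal 0 1))
    (hp0 : 0 ≤ p) (hp1 : p ≤ 1) {θ : ℝ} (hd : DifferentiableAt ℝ (psi h p) θ) :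
    |2 * p - 1| * (gaussianReal 0 1).real {t | h t = θ} = 0 := by
  set γ := gaussianReal 0 1
  set m := γ.real {t | h t = θ}
  have i (θ : ℝ) := (memLp_score hh h2 hp0 hp1 θ).integrable one_le_two
  have hms : MeasurableSet {t | h t = θ} := hh (measurableSet_singleton θ)
  -- The symmetric second difference of `psi` is `2 * p - 1` times the mean of a tent of height `d`
  -- at `θ`, so an atom makes it at least linear in `d`, while differentiability makes it o(d).
  have hlow (d : ℝ) (hd0 : 0 < d) :
      d * (|2 * p - 1| * m) ≤ |psi h p (θ + d) + psi h p (θ - d) - 2 * psi h p θ| := by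
    have e : psi h p (θ + d) + psi h p (θ - d) - 2 * psi h p θ =
        (2 * p - 1) * ∫ t, max (d - |h t - θ|) 0 ∂γ := by
      have hadd : Integrable (fun t => weight p (h t) (θ + d) * (h t - (θ + d)) +
        weight p (h t) (θ - d) * (h t - (θ - d))) γ := (i _).add (i _)
      simp only [psi]
      rw [← integral_const_mul, ← integral_const_mul, ← integral_add (i _) (i _),
        ← integral_sub hadd ((i _).const_mul 2)]
      congr 1 with t
      rw [weight_mul_sub hp0 hp1, weight_mul_sub hp0 hp1, weight_mul_sub hp0 hp1]
      have : max (θ + d - h t) 0 + max (θ - d - h t) 0 - 2 * max (θ - h t) 0 =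
          max (d - |h t - θ|) 0 := by
        rcases le_total (h t) θ with h1 | h1
        · rw [abs_of_nonpos (by linarith), max_eq_left (a := θ - h t) (by linarith),
            max_eq_left (a := θ + d - h t) (by linarith)]
          rcases le_total (θ - d - h t) 0 with h3 | h3
          · rw [max_eq_right h3, max_eq_left (by linarith)]; ring
          · rw [max_eq_left h3, max_eq_right (by linarith)]; ring
        · rw [abs_of_nonneg (by linarith), max_eq_right (a := θ - h t) (by linarith),
            max_eq_right (a := θ - d - h t) (by linarith)]
          rw [show θ + d - h t = d - (h t - θ) by ring]; ring
      rw [← this]; ring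
    have hi : Integrable (fun t => max (d - |h t - θ|) 0) γ := by
      refine Integrable.of_bound (C := d) (Measurable.aestronglyMeasurable (by fun_prop))
        (ae_of_all _ fun t => ?_)
      rw [Real.norm_of_nonneg (le_max_right _ _)]
      exact max_le (by linarith [abs_nonneg (h t - θ)]) hd0.le
    have hle : d * m ≤ ∫ t, max (d - |h t - θ|) 0 ∂γ := by
      have h4 : ∫ t, {t | h t = θ}.indicator (fun _ => d) t ∂γ = d * m := by
        rw [integral_indicator_const _ hms, smul_eq_mul, mul_comm]
      rw [← h4]
      refine integral_mono ((integrable_const d).indicator hms) hi fun t => ?_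
      by_cases ht : h t = θ
      · rw [Set.indicator_of_mem (by exact ht)]; simp [ht]
      · rw [Set.indicator_of_notMem (by exact ht)]; exact le_max_right _ _
    rw [e, abs_mul, mul_left_comm]
    exact mul_le_mul_of_nonneg_left (hle.trans (le_abs_self _)) (abs_nonneg _)
  have hD := hd.hasDerivAt
  have hr : HasDerivAt (fun d => psi h p (θ + d)) (deriv (psi h p) θ) 0 :=
    HasDerivAt.comp_const_add θ 0 (by simpa using hD)
  have hl : HasDerivAt (fun d => psi h p (θ - d)) (-deriv (psi h p) θ) 0 :=
    HasDerivAt.comp_const_sub θ 0 (by simpa using hD)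
  have hs := ((hr.add hl).sub_const (2 * psi h p θ)).tendsto_slope_zero_right
  simp only [Pi.add_apply, add_zero, sub_zero, zero_add, add_neg_cancel, smul_eq_mul] at hs
  have hlim : |2 * p - 1| * m ≤ |(0 : ℝ)| := by
    refine ge_of_tendsto hs.abs ?_
    filter_upwards [self_mem_nhdsWithin] with d hd0
    have hd0 : 0 < d := hd0
    rw [abs_mul, abs_inv, abs_of_pos hd0, inv_mul_eq_div, le_div_iff₀ hd0, mul_comm]
    refine (hlow d hd0).trans_eq ?_
    congr 1; ring
  rw [abs_zero] at hlim
  exact le_antisymm hlim (by positivity)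

theorem exists_abs_mul_measureReal_lt (hh : Measurable h) {θ : ℝ}
    (h0 : |2 * p - 1| * (gaussianReal 0 1).real {t | h t = θ} = 0) {η : ℝ} (hη : 0 < η) :
    ∃ δ > 0, |2 * p - 1| * (gaussianReal 0 1).real {t | |h t - θ| ≤ δ} < η := by
  set γ := gaussianReal 0 1
  set s : ℕ → Set ℝ := fun k => {t | |h t - θ| ≤ 1 / ((k : ℝ) + 1)}
  have hs : ⋂ k, s k = {t | h t = θ} := by
    ext t
    simp only [s, Set.mem_iInter, Set.mem_ofPred_eq]
    constructor
    · intro H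
      have h1 := ge_of_tendsto' tendsto_one_div_add_atTop_nhds_zero_nat H
      exact sub_eq_zero.1 (abs_eq_zero.1 (le_antisymm h1 (abs_nonneg _)))
    · intro H k
      rw [H, sub_self, abs_zero]; positivity
  have hanti : Antitone s := fun k l hkl t ht =>
    le_trans (show |h t - θ| ≤ _ from ht) (one_div_le_one_div_of_le (by positivity)
      (by exact_mod_cast Nat.succ_le_succ hkl))
  have hmeas (k : ℕ) : MeasurableSet (s k) :=
    measurableSet_le (by fun_prop) measurable_const
  have ht := tendsto_measure_iInter_atTop (μ := γ) (fun k => (hmeas k).nullMeasurableSet) hanti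
    ⟨0, measure_ne_top _ _⟩
  rw [hs] at ht
  have ht' := ((ENNReal.tendsto_toReal (measure_ne_top γ _)).comp ht).const_mul |2 * p - 1|
  have h0' : |2 * p - 1| * (γ {t | h t = θ}).toReal = 0 := h0
  rw [h0'] at ht'
  obtain ⟨k, hk⟩ := (ht'.eventually (gt_mem_nhds hη)).exists
  exact ⟨1 / ((k : ℝ) + 1), by positivity, hk⟩

end Population

/-! ### Linearisation and conclusion -/

/-- Linearisation of the sample expectile around `θ`: `b` stands for the mean weight. -/
theorem abs_sampleExpectile_sub_sub_le {p : ℝ} (hp0 : 0 < p) (hp1 : p < 1) {n : ℕ} (hn : n ≠ 0)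
    (z : ℕ → ℝ) {θ b δ : ℝ} (hb : min p (1 - p) ≤ b) (hδ : |sampleExpectile n z p - θ| ≤ δ) :
    |(sampleExpectile n z p - θ) - samplePsi n z p θ / b| * min p (1 - p) ^ 2 ≤
      |samplePsi n z p θ| *
        (|(1 / (n : ℝ)) * ∑ i ∈ Finset.range n, weight p (z i) θ - b| + |2 * p - 1| *
          ((1 / (n : ℝ)) * ∑ i ∈ Finset.range n, {y : ℝ | |y - θ| ≤ δ}.indicator 1 (z i))) := by
  set c := min p (1 - p)
  have hc : 0 < c := lt_min hp0 (by linarith)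
  set D := sampleExpectile n z p - θ with hD
  set W := (1 / (n : ℝ)) * ∑ i ∈ Finset.range n, weight p (z i) θ with hW
  set N := (1 / (n : ℝ)) * ∑ i ∈ Finset.range n, {y : ℝ | |y - θ| ≤ δ}.indicator (1 : ℝ → ℝ) (z i)
    with hN
  have hn' : (0 : ℝ) ≤ 1 / (n : ℝ) := by positivity
  have hN0 : 0 ≤ N :=
    mul_nonneg hn' (Finset.sum_nonneg fun i _ => Set.indicator_nonneg (fun _ _ => zero_le_one) _)
  -- The score vanishes at the sample expectile, so averaging the individual expansions leaves only
  -- their remainders.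
  have hR : |D * W - samplePsi n z p θ| ≤ |D| * (|2 * p - 1| * N) := by
    have e : D * W - samplePsi n z p θ = (1 / (n : ℝ)) * ∑ i ∈ Finset.range n,
        (weight p (z i) (sampleExpectile n z p) * (z i - sampleExpectile n z p) -
          weight p (z i) θ * (z i - θ) + D * weight p (z i) θ) := by
      have h0 := samplePsi_sampleExpectile hp0 hp1 hn z
      rw [samplePsi] at h0
      rw [Finset.sum_add_distrib, Finset.sum_sub_distrib, mul_add, mul_sub, h0, hW, samplePsi,
        ← Finset.mul_sum]
      ring
    rw [e, abs_mul, abs_of_nonneg hn', hN, mul_left_comm |2 * p - 1|, mul_left_comm |D|,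
      Finset.mul_sum, Finset.mul_sum]
    exact mul_le_mul_of_nonneg_left ((Finset.abs_sum_le_sum_abs _ _).trans
      (Finset.sum_le_sum fun i _ => abs_score_expansion_le hp0.le hp1.le _ _ _ hδ)) hn'
  have hS : c * |D| ≤ |samplePsi n z p θ| := mul_abs_sampleExpectile_sub_le hp0 hp1 hn z θ
  have hb0 : 0 < b := hc.trans_le hb
  have h1 : |D - samplePsi n z p θ / b| * b ≤ |D| * (|W - b| + |2 * p - 1| * N) := by
    calc |D - samplePsi n z p θ / b| * b = |(D - samplePsi n z p θ / b) * b| := by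
          rw [abs_mul, abs_of_pos hb0]
      _ = |(D * W - samplePsi n z p θ) - D * (W - b)| := by congr 1; field_simp; ring
      _ ≤ |D * W - samplePsi n z p θ| + |D * (W - b)| := abs_sub _ _
      _ ≤ |D| * (|2 * p - 1| * N) + |D| * |W - b| := by rw [abs_mul D]; gcongr
      _ = _ := by ring
  -- One factor `c` bounds `b` from below, the other turns `|D|` into the sample score.
  calc |D - samplePsi n z p θ / b| * c ^ 2 = c * (|D - samplePsi n z p θ / b| * c) := by ring
    _ ≤ c * (|D - samplePsi n z p θ / b| * b) := by gcongr
    _ ≤ c * (|D| * (|W - b| + |2 * p - 1| * N)) := by gcongr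
    _ = (c * |D|) * (|W - b| + |2 * p - 1| * N) := by ring
    _ ≤ _ := by gcongr

/-- Prepares Markov's inequality: either failure event is dominated by an expression in moments. The
product is split by the weighted inequality 2xy ≤ x² + y² with free parameter `l`; `M ≤ 1` gives `M
^ 2 ≤ M`, so only the mean of `M` is needed. -/
theorem one_le_of_small_or_large {c δ ε r l S V M : ℝ} (hc : 0 < c) (hδ : 0 < δ) (hε : 0 < ε)
    (hr : 0 < r) (hl : 0 < l) (hM0 : 0 ≤ M) (hM1 : M ≤ 1)
    (H : c * δ ≤ |S| ∨ ε * r * c ^ 2 ≤ |S| * (|V| + M)) :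
    1 ≤ (1 / (c * δ) ^ 2) * S ^ 2 + (l / (2 * ε * c ^ 2) / r ^ 2) * S ^ 2 +
      (1 / (l * ε * c ^ 2)) * (V ^ 2 + M) := by
  have t1 : 0 ≤ (1 / (c * δ) ^ 2) * S ^ 2 := by positivity
  have t2 : 0 ≤ (l / (2 * ε * c ^ 2) / r ^ 2) * S ^ 2 := by positivity
  have t3 : 0 ≤ (1 / (l * ε * c ^ 2)) * (V ^ 2 + M) := by positivity
  rcases H with H | H
  · have : 1 ≤ (1 / (c * δ) ^ 2) * S ^ 2 := by
      rw [one_div, inv_mul_eq_div, one_le_div (by positivity), ← sq_abs S]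
      gcongr
    linarith
  · have hA : (|V| + M) ^ 2 ≤ 2 * (V ^ 2 + M) := by
      have : M ^ 2 ≤ M := by nlinarith
      nlinarith [sq_nonneg (|V| - M), sq_abs V]
    have hAG : 2 * l * r * (|S| * (|V| + M)) ≤ l ^ 2 * S ^ 2 + r ^ 2 * (|V| + M) ^ 2 := by
      nlinarith [sq_nonneg (l * |S| - r * (|V| + M)), sq_abs S]
    have h1 : 2 * l * r * (ε * r * c ^ 2) ≤ l ^ 2 * S ^ 2 + r ^ 2 * (2 * (V ^ 2 + M)) := by
      have := mul_le_mul_of_nonneg_left H (by positivity : 0 ≤ 2 * l * r)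
      have := mul_le_mul_of_nonneg_left hA (sq_nonneg r)
      linarith
    have e : (l / (2 * ε * c ^ 2) / r ^ 2) * S ^ 2 + (1 / (l * ε * c ^ 2)) * (V ^ 2 + M) =
        (l ^ 2 * S ^ 2 + r ^ 2 * (2 * (V ^ 2 + M))) / (2 * l * r * (ε * r * c ^ 2)) := by
      field_simp
    have : 1 ≤ (l ^ 2 * S ^ 2 + r ^ 2 * (2 * (V ^ 2 + M))) / (2 * l * r * (ε * r * c ^ 2)) :=
      (one_le_div (by positivity)).2 h1
    linarith

/-- Centering kills the Hermite coefficient of index 0, so the second moment is bounded by a Cesàro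
mean of `|ρ|`. -/
theorem IsStationaryGaussian.tendsto_integral_sq_pathMean {Ω : Type*} [MeasurableSpace Ω]
    {P : Measure Ω} {Y : ℕ → Ω → ℝ} {ρ : ℕ → ℝ} (hY : IsStationaryGaussian P Y ρ)
    (hρ : Tendsto ρ atTop (𝓝 0)) {f : ℝ → ℝ} (hf : MemLp f 2 (gaussianReal 0 1))
    (h0 : ∫ x, f x ∂(gaussianReal 0 1) = 0) :
    Tendsto (fun n => ∫ ω, pathMean Y f n ω ^ 2 ∂P) atTop (𝓝 0) := by
  have hces := (hρ.abs.cesaro).const_mul (2 * ∫ x, f x ^ 2 ∂(gaussianReal 0 1))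
  rw [abs_zero, mul_zero] at hces
  refine squeeze_zero (fun n => integral_nonneg fun ω => sq_nonneg _) (fun n => ?_) hces
  have h := hY.integral_sq_pathMean_le hf (m := 1)
    (fun j hj => by rw [Nat.lt_one_iff.1 hj]; simpa [hermiteCoeff] using h0) n
  simpa only [pow_one, one_div] using h

end Expectile

open Expectile in
theorem theorem1 {Ω : Type*} [MeasurableSpace Ω] (P : Measure Ω) [IsProbabilityMeasure P]
    (Y : ℕ → Ω → ℝ) (ρ : ℕ → ℝ) (hY : Expectile.IsStationaryGaussian P Y ρ)
    (κ α : ℝ) (hα : 0 < α)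
    (hρ : Tendsto (fun i : ℕ => ρ i * (i : ℝ) ^ α) atTop (𝓝 κ))
    (p : ℝ) (hp0 : 0 < p) (hp1 : p < 1)
    (h : ℝ → ℝ) (hA : Expectile.AssumptionA h p)
    (τ : ℕ)
    (hτ : Expectile.IsHermiteRank (Expectile.centeredScore h p (Expectile.expectile h p)) τ) :
    Expectile.IsLittleOP P
      (fun n ω =>
        (Expectile.sampleExpectile n (fun i => h (Y i ω)) p - Expectile.expectile h p) -
          (-(Expectile.samplePsi n (fun i => h (Y i ω)) p (Expectile.expectile h p) /
            Expectile.psi' h p (Expectile.expectile h p))))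
      (Expectile.rate α τ) := by
  have hh := hA.measurable
  have h2 := hA.memLp_two
  set E := expectile h p with hE
  set γ := gaussianReal 0 1
  have hpsi : psi h p E = 0 := psi_expectile hh h2 hp0 hp1
  set c := min p (1 - p) with hcdef
  have hc : 0 < c := lt_min hp0 (by linarith)
  set b := -psi' h p E with hb
  have hbc : c ≤ b := min_le_neg_psi' hh hp0.le hp1.le E
  set g : ℝ → ℝ := fun t => weight p (h t) E * (h t - E) with hg
  -- The score vanishes at the expectile, so the centering is void and the rank is that of `g`.
  have hgcs : centeredScore h p E = g := by
    funext t; simp [centeredScore, hpsi, hg]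
  rw [hgcs] at hτ
  have hgL : MemLp g 2 γ := memLp_score hh h2 hp0.le hp1.le E
  have hg0 : ∫ t, g t ∂γ = 0 := hpsi
  have hgrank (j : ℕ) (hj : j < τ) : hermiteCoeff g j = 0 := by
    by_contra hne
    exact absurd (hτ.2 hne) (not_le.2 hj)
  set w : ℝ → ℝ := fun t => weight p (h t) E - b with hw
  have hwL : MemLp w 2 γ := (memLp_weight hh hp0.le hp1.le E 2).sub (memLp_const b)
  have hw0 : ∫ t, w t ∂γ = 0 := by
    rw [hw, integral_sub ((memLp_weight hh hp0.le hp1.le E 1).integrable le_rfl)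
      (integrable_const b), integral_const, hb, psi']
    simp
  have hρ0 := tendsto_zero_of_tendsto_mul_rpow hα hρ
  have hgT := hY.tendsto_integral_sq_pathMean hρ0 hgL hg0
  have hwT := hY.tendsto_integral_sq_pathMean hρ0 hwL hw0
  have hgR : ∃ K, 0 ≤ K ∧ ∀ᶠ n in atTop, ∫ ω, pathMean Y g n ω ^ 2 ∂P ≤ K * rate α τ n ^ 2 := by
    obtain ⟨C, hC0, hC⟩ := exists_mean_abs_pow_le_rate_sq hα hρ τ
    have hg2 : 0 ≤ ∫ x, g x ^ 2 ∂γ := integral_nonneg fun x => sq_nonneg _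
    refine ⟨2 * (∫ x, g x ^ 2 ∂γ) * C, by positivity, ?_⟩
    filter_upwards [hC] with n hn
    refine (hY.integral_sq_pathMean_le hgL hgrank n).trans ?_
    rw [mul_assoc (2 * ∫ x, g x ^ 2 ∂γ)]
    exact mul_le_mul_of_nonneg_left hn (by positivity)
  obtain ⟨K, hK0, hK⟩ := hgR
  obtain ⟨U, hUo, hEU, hUC⟩ := hA.contDiffOn_nhds
  have hdiff : DifferentiableAt ℝ (psi h p) E :=
    (hUC.differentiableOn one_ne_zero).differentiableAt (hUo.mem_nhds hEU)
  have hatom := abs_mul_measureReal_eq_zero hh h2 hp0.le hp1.le hdiff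
  rw [IsLittleOP, tendstoInMeasure_iff_measureReal_norm]
  intro ε hε
  rw [Metric.tendsto_atTop']
  simp only [dist_zero_right, Real.norm_of_nonneg measureReal_nonneg, sub_zero]
  suffices ∀ η > 0, ∀ᶠ n in atTop, P.real {ω | ε ≤
      ‖(sampleExpectile n (fun i => h (Y i ω)) p - E -
        -(samplePsi n (fun i => h (Y i ω)) p E / psi' h p E)) / rate α τ n‖} < η by
    intro η hη
    obtain ⟨n₀, hn₀⟩ := eventually_atTop.1 (this η hη)
    exact ⟨n₀, fun n hn => hn₀ n hn.le⟩
  intro η hη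
  -- Chosen so that the term in `S ^ 2 / r ^ 2` has mean at most `η / 4 * (K / (K + 1))`; `K + 1`
  -- avoids division by zero. Then `δ` is chosen from `l`, before `n`.
  set l := η * ε * c ^ 2 / (2 * (K + 1)) with hl
  have hl0 : 0 < l := by positivity
  obtain ⟨δ, hδ0, hδ⟩ := exists_abs_mul_measureReal_lt (p := p) hh hatom
    (η := η / 4 * (l * ε * c ^ 2)) (by positivity)
  set B : Set ℝ := {t | |h t - E| ≤ δ} with hBdef
  have hB : MeasurableSet B := measurableSet_le (by fun_prop) measurable_const
  have hBi : Integrable (B.indicator (1 : ℝ → ℝ)) γ := (integrable_const (1 : ℝ)).indicator hB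
  filter_upwards [hK, eventually_ge_atTop 2,
    hgT.eventually (gt_mem_nhds (by positivity : 0 < η / 4 * (c * δ) ^ 2)),
    hwT.eventually (gt_mem_nhds (by positivity : 0 < η / 4 * (l * ε * c ^ 2)))]
    with n hnK hn2 hnS hnV
  have hn0 : n ≠ 0 := by omega
  have hr := rate_pos α τ hn2
  set r := rate α τ n
  have hS : Integrable (fun ω => pathMean Y g n ω ^ 2) P := (hY.memLp_pathMean hgL n).integrable_sq
  have hV : Integrable (fun ω => pathMean Y w n ω ^ 2) P := (hY.memLp_pathMean hwL n).integrable_sq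
  have hN : Integrable (fun ω => |2 * p - 1| * pathMean Y (B.indicator 1) n ω) P :=
    (memLp_one_iff_integrable.1
      (hY.memLp_pathMean (memLp_one_iff_integrable.2 hBi) n)).const_mul _
  have hNnonneg (ω : Ω) : 0 ≤ pathMean Y (B.indicator 1) n ω :=
    mul_nonneg (by positivity)
      (Finset.sum_nonneg fun i _ => Set.indicator_nonneg (fun _ _ => zero_le_one) _)
  have hNle (ω : Ω) : pathMean Y (B.indicator 1) n ω ≤ 1 := by
    have hn' : (0 : ℝ) < n := by exact_mod_cast Nat.pos_of_ne_zero hn0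
    have h1 : ∑ i ∈ Finset.range n, B.indicator (1 : ℝ → ℝ) (Y i ω) ≤
        ∑ _i ∈ Finset.range n, (1 : ℝ) :=
      Finset.sum_le_sum fun i _ => Set.indicator_le_self' (fun _ _ => zero_le_one) _
    rw [Finset.sum_const, Finset.card_range, nsmul_eq_mul, mul_one] at h1
    rw [pathMean, one_div, inv_mul_eq_div, div_le_one hn']
    exact h1
  set Z : Ω → ℝ := fun ω => (1 / (c * δ) ^ 2) * pathMean Y g n ω ^ 2 +
    (l / (2 * ε * c ^ 2) / r ^ 2) * pathMean Y g n ω ^ 2 +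
      (1 / (l * ε * c ^ 2)) * (pathMean Y w n ω ^ 2 +
        |2 * p - 1| * pathMean Y (B.indicator 1) n ω) with hZ
  have hZint : Integrable Z P :=
    ((hS.const_mul _).add (hS.const_mul _)).add ((hV.add hN).const_mul _)
  have hZ0 (ω : Ω) : 0 ≤ Z ω := by
    have := hNnonneg ω
    positivity
  have hZval : ∫ ω, Z ω ∂P = (1 / (c * δ) ^ 2) * (∫ ω, pathMean Y g n ω ^ 2 ∂P) +
      (l / (2 * ε * c ^ 2) / r ^ 2) * (∫ ω, pathMean Y g n ω ^ 2 ∂P) +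
      (1 / (l * ε * c ^ 2)) * ((∫ ω, pathMean Y w n ω ^ 2 ∂P) + |2 * p - 1| * γ.real B) := by
    have hVN : Integrable (fun ω => pathMean Y w n ω ^ 2 +
        |2 * p - 1| * pathMean Y (B.indicator 1) n ω) P := hV.add hN
    have hSS : Integrable (fun ω => (1 / (c * δ) ^ 2) * pathMean Y g n ω ^ 2 +
        (l / (2 * ε * c ^ 2) / r ^ 2) * pathMean Y g n ω ^ 2) P :=
      (hS.const_mul _).add (hS.const_mul _)
    rw [hZ, integral_add hSS (hVN.const_mul _), integral_add (hS.const_mul _) (hS.const_mul _),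
      integral_const_mul, integral_const_mul, integral_const_mul, integral_add hV hN,
      integral_const_mul, hY.integral_pathMean hBi hn0, integral_indicator_one hB]
  have hsub : {ω | ε ≤ ‖(sampleExpectile n (fun i => h (Y i ω)) p - E -
      -(samplePsi n (fun i => h (Y i ω)) p E / psi' h p E)) / r‖} ⊆ {ω | 1 ≤ Z ω} := by
    intro ω hω
    have hω' : ε ≤ ‖(sampleExpectile n (fun i => h (Y i ω)) p - E -
      -(samplePsi n (fun i => h (Y i ω)) p E / psi' h p E)) / r‖ := hω
    refine one_le_of_small_or_large hc hδ0 hε hr hl0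
      (mul_nonneg (abs_nonneg _) (hNnonneg ω))
      (mul_le_one₀ (abs_le.2 ⟨by linarith, by linarith⟩) (hNnonneg ω) (hNle ω)) ?_
    have hSeq : pathMean Y g n ω = samplePsi n (fun i => h (Y i ω)) p E := rfl
    have hVeq : pathMean Y w n ω =
        (1 / (n : ℝ)) * ∑ i ∈ Finset.range n, weight p (h (Y i ω)) E - b := by
      have hn' : (n : ℝ) ≠ 0 := by exact_mod_cast hn0
      simp only [pathMean, hw, Finset.sum_sub_distrib, Finset.sum_const, Finset.card_range,
        nsmul_eq_mul]
      field_simp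
    rw [hSeq]
    rcases le_or_gt |sampleExpectile n (fun i => h (Y i ω)) p - E| δ with hD | hD
    · right
      rw [hVeq]
      refine le_trans ?_ (abs_sampleExpectile_sub_sub_le hp0 hp1 hn0 (fun i => h (Y i ω)) hbc hD)
      refine mul_le_mul_of_nonneg_right ?_ (sq_nonneg c)
      rw [norm_div, Real.norm_of_nonneg hr.le, le_div_iff₀ hr] at hω'
      refine hω'.trans_eq ?_
      rw [Real.norm_eq_abs, hb, div_neg]
    · left
      exact (mul_le_mul_of_nonneg_left hD.le hc.le).trans
        (mul_abs_sampleExpectile_sub_le hp0 hp1 hn0 _ E)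
  -- Markov at level 1; the three terms of the mean of `Z` are allotted `η / 4`, `η / 4` and `η /
  -- 2`.
  have hmarkov := mul_meas_ge_le_integral_of_nonneg (ae_of_all P hZ0) hZint 1
  rw [one_mul, hZval] at hmarkov
  refine ((measureReal_mono hsub).trans hmarkov).trans_lt ?_
  have q1 : (1 / (c * δ) ^ 2) * (∫ ω, pathMean Y g n ω ^ 2 ∂P) < η / 4 := by
    rw [one_div, inv_mul_eq_div, div_lt_iff₀ (by positivity)]; exact hnS
  have q2 : (l / (2 * ε * c ^ 2) / r ^ 2) * (∫ ω, pathMean Y g n ω ^ 2 ∂P) ≤ η / 4 := by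
    calc _ ≤ (l / (2 * ε * c ^ 2) / r ^ 2) * (K * r ^ 2) := by gcongr
      _ = η / 4 * (K / (K + 1)) := by rw [hl]; field_simp; ring
      _ ≤ η / 4 * 1 := by
          gcongr
          exact (div_le_one (by positivity)).2 (by linarith)
      _ = η / 4 := mul_one _
  have q3 : (1 / (l * ε * c ^ 2)) * ((∫ ω, pathMean Y w n ω ^ 2 ∂P) + |2 * p - 1| * γ.real B) <
      η / 2 := by
    rw [one_div, inv_mul_eq_div, div_lt_iff₀ (by positivity)]
    linarith
  linarith
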